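/- **Setting.** The bicategory $\mathbf{LexProf}$ has as objects the small categories with finite limits. Its hom-category from $\mathbb A$ to $\mathbb B$ is $[\mathbb A^{\mathrm{op}},\mathbf{FL}(\mathbb B,\mathbf{Set})]$, where $\mathbf{FL}$ denotes finite-limit-preserving functors; so a $1$-cell is a functor $M\colon\mathbb A^{\mathrm{op}}\times\mathbb B\to\mathbf{Set}$ preserving finite limits in the second variable. The identity on $\mathbb A$ is $\mathbb A(a',a)$, and composition is $(N\otimes M)(a,c)=\int^{b}N(b,c)\times M(a,b)$. A $\mathbf{LexProf}$-category $\mathcal C$ has objects $X$, each with an extent $\epsilon X\in\mathbf{LexProf}$, hom $1$-cells $\mathcal C(X,Y)\colon \epsilon X\to\epsilon Y$, compositions $\mathcal C(Y,Z)\otimes\mathcal C(X,Y)\to\mathcal C(X,Z)$ and identities $I_{\epsilon X}\to\mathcal C(X,X)$ that are associative and unital. Functors $F\colon \mathcal C\to\mathcal D$ preserve extents and consist of $2$-cells $\mathcal C(X,Y)\to\mathcal D(FX,FY)$ compatible with composition and identities. Transformations $F\Rightarrow G$ are families $I_{\epsilon X}\to\mathcal D(FX,GX)$ natural in $X$. These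 form a $2$-category $\mathbf{LexProf}\text{-}\mathbf{CAT}$. A tensor of $X\in\mathcal C$ of extent $\mathbb A$ by $P\colon\mathbb A\to\mathbb B$ is an object $P\ast X$ of extent $\mathbb B$ with a $2$-cell $P\to\mathcal C(X,P\ast X)$ such that, for every $Z$ of any extent $\mathbb C$ and every $U\colon\mathbb B\to\mathbb C$, the induced map from $2$-cells $U\to\mathcal C(P\ast X,Z)$ to $2$-cells $U\otimes P\to\mathcal C(X,Z)$ is bijective; $\mathcal C$ is tensored if all tensors exist. Let $\mathbb S$ be the $\mathbf{LexProf}$-category whose objects of extent $\mathbb A$ are the finite-limit-preserving functors $\mathbb A\to\mathbf{Set}$, with $\mathbb S(X,Y)(a,b)=\mathbf{Set}(Xa,Yb)$ and with composition and identities those of functions. Let $\mathcal A$ be a locally finitely presentable category, let $\iota\colon\mathcal A_f\to\mathcal A$ be a small category equivalent to the full subcategory of finitely presentable objects, and let $\mathbf{Mnd}_f(\mathcal A)$ be the category of finitary monads on $\mathcal A$ (those whose underlying functor preserves filtered colimits). The embedding of $\mathbf{Mnd}_f(\mathcal A)$ into $\mathbf{LexProf}\text{-}\mathbf{CAT}$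 sends $T$ to the $\mathbf{LexProf}$-category $\mathcal T$ with a single object, of extent $\mathcal A_f^{\mathrm{op}}$, and hom $1$-cell $(i,j)\mapsto\mathcal A(\iota j,T\iota i)$; identities are given by the unit of $T$ and composition is Kleisli composition. A map of monads acts by postcomposition. **Proposition.** The $\mathbf{LexProf}$-category $\mathbb S$ is tensored, and the triangle formed by the embedding $\mathbf{Mnd}_f(\mathcal A)^{\mathrm{op}}\to(\mathbf{LexProf}\text{-}\mathbf{CAT})^{\mathrm{op}}$, the functor $(-)\text{-}\mathbf{Alg}\colon\mathbf{Mnd}_f(\mathcal A)^{\mathrm{op}}\to\mathbf{CAT}$, and $\mathbf{LexProf}\text{-}\mathbf{CAT}(-,\mathbb S)\colon(\mathbf{LexProf}\text{-}\mathbf{CAT})^{\mathrm{op}}\to\mathbf{CAT}$ commutes up to pseudonatural equivalence. That is, there are equivalences of categories $$T\text{-}\mathbf{Alg}\;\simeq\;\mathbf{LexProf}\text{-}\mathbf{CAT}(\mathcal T,\mathbb S),$$ pseudonatural in $T\in\mathbf{Mnd}_f(\mathcal A)^{\mathrm{op}}$. -/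

import Mathlib

open CategoryTheory Bicategory Limits Opposite

universe t w v u

/-- A category enriched in a bicategory `W`.  The objects are given as a family indexed by their
extents: `Obj a` is the type of objects of extent `a`.  With Mathlib's diagrammatic notation `≫`
for the composition of `1`-cells, `hom Y Z ⊗ hom X Y` is `hom X Y ≫ hom Y Z`. -/
structure EnrCat (W : Type u) [Bicategory.{w, v} W] where
  Obj : W → Type t
  hom {a b : W} (X : Obj a) (Y : Obj b) : a ⟶ b
  comp {a b c : W} (X : Obj a) (Y : Obj b) (Z : Obj c) : hom X Y ≫ hom Y Z ⟶ hom X Z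
  ident {a : W} (X : Obj a) : 𝟙 a ⟶ hom X X
  assoc {a b c d : W} (X : Obj a) (Y : Obj b) (Z : Obj c) (T : Obj d) :
    comp X Y Z ▷ hom Z T ≫ comp X Z T =
      (α_ (hom X Y) (hom Y Z) (hom Z T)).hom ≫ hom X Y ◁ comp Y Z T ≫ comp X Y T
  ident_comp {a b : W} (X : Obj a) (Y : Obj b) :
    ident X ▷ hom X Y ≫ comp X X Y = (λ_ (hom X Y)).hom
  comp_ident {a b : W} (X : Obj a) (Y : Obj b) :
    hom X Y ◁ ident Y ≫ comp X Y Y = (ρ_ (hom X Y)).hom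

/-- A functor between categories enriched in a bicategory; it preserves extents. -/
@[ext]
structure EnrFunctor {W : Type u} [Bicategory.{w, v} W] (C D : EnrCat.{t} W) where
  obj {a : W} (X : C.Obj a) : D.Obj a
  map {a b : W} (X : C.Obj a) (Y : C.Obj b) : C.hom X Y ⟶ D.hom (obj X) (obj Y)
  map_ident {a : W} (X : C.Obj a) : C.ident X ≫ map X X = D.ident (obj X)
  map_comp {a b c : W} (X : C.Obj a) (Y : C.Obj b) (Z : C.Obj c) :
    C.comp X Y Z ≫ map X Z =
      (map X Y ▷ C.hom Y Z ≫ D.hom (obj X) (obj Y) ◁ map Y Z) ≫ D.comp (obj X) (obj Y) (obj Z)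

namespace EnrCat

variable {W : Type u} [Bicategory.{w, v} W]

/-- The composite `p ≫ q ⟶ hom X Y ≫ hom Y Z ⟶ hom X Z`. -/
def mul (C : EnrCat.{t} W) {a b c : W} {X : C.Obj a} {Y : C.Obj b} {Z : C.Obj c}
    {p : a ⟶ b} {q : b ⟶ c} (f : p ⟶ C.hom X Y) (g : q ⟶ C.hom Y Z) : p ≫ q ⟶ C.hom X Z :=
  (f ▷ q ≫ C.hom X Y ◁ g) ≫ C.comp X Y Z

section
variable (C : EnrCat.{t} W) {a b c d : W} {X : C.Obj a} {Y : C.Obj b} {Z : C.Obj c} {T : C.Obj d}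

lemma whiskerRight_mul {p p' : a ⟶ b} {q : b ⟶ c} (u : p' ⟶ p) (f : p ⟶ C.hom X Y)
    (g : q ⟶ C.hom Y Z) : u ▷ q ≫ C.mul f g = C.mul (u ≫ f) g := by
  simp [mul]

lemma whiskerLeft_mul {p : a ⟶ b} {q q' : b ⟶ c} (u : q' ⟶ q) (f : p ⟶ C.hom X Y)
    (g : q ⟶ C.hom Y Z) : p ◁ u ≫ C.mul f g = C.mul f (u ≫ g) := by
  simp [mul, whisker_exchange_assoc]

lemma mul_mul {p : a ⟶ b} {q : b ⟶ c} {r : c ⟶ d} (f : p ⟶ C.hom X Y)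
    (g : q ⟶ C.hom Y Z) (h : r ⟶ C.hom Z T) :
    C.mul (C.mul f g) h = (α_ p q r).hom ≫ C.mul f (C.mul g h) := by
  have h : C.comp X Y Z ▷ r ≫ C.hom X Z ◁ h ≫ C.comp X Z T =
      (α_ _ _ _).hom ≫ C.hom X Y ◁ C.hom Y Z ◁ h ≫ C.hom X Y ◁ C.comp Y Z T ≫ C.comp X Y T := by
    rw [← whisker_exchange_assoc, C.assoc]
    simp
  simp [mul, h]

lemma ident_mul {q : a ⟶ b} (g : q ⟶ C.hom X Y) : C.mul (C.ident X) g = (λ_ q).hom ≫ g := by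
  simp [mul, ← whisker_exchange_assoc, C.ident_comp]

lemma mul_ident {p : a ⟶ b} (f : p ⟶ C.hom X Y) : C.mul f (C.ident Y) = (ρ_ p).hom ≫ f := by
  simp [mul, C.comp_ident]

lemma unit_ident_mul {X Y : C.Obj a} (f : 𝟙 a ⟶ C.hom X Y) :
    (λ_ (𝟙 a)).inv ≫ C.mul (C.ident X) f = f := by
  simp [ident_mul]

lemma unit_mul_ident {X Y : C.Obj a} (f : 𝟙 a ⟶ C.hom X Y) :
    (λ_ (𝟙 a)).inv ≫ C.mul f (C.ident Y) = f := by
  simp [mul_ident, unitors_inv_equal]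

end

end EnrCat

namespace EnrFunctor

variable {W : Type u} [Bicategory.{w, v} W] {C D E : EnrCat.{t} W}

lemma mul_map (F : EnrFunctor C D) {a b c : W} {X : C.Obj a} {Y : C.Obj b} {Z : C.Obj c}
    {p : a ⟶ b} {q : b ⟶ c} (f : p ⟶ C.hom X Y) (g : q ⟶ C.hom Y Z) :
    C.mul f g ≫ F.map X Z = D.mul (f ≫ F.map X Y) (g ≫ F.map Y Z) := by
  simp [EnrCat.mul, F.map_comp, whisker_exchange_assoc]

/-- The identity enriched functor. -/
@[simps]
def id (C : EnrCat.{t} W) : EnrFunctor C C where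
  obj X := X
  map X Y := 𝟙 _
  map_ident X := by simp
  map_comp X Y Z := by simp

/-- Composition of enriched functors. -/
@[simps]
def comp (F : EnrFunctor C D) (G : EnrFunctor D E) : EnrFunctor C E where
  obj X := G.obj (F.obj X)
  map X Y := F.map X Y ≫ G.map _ _
  map_ident X := by rw [← Category.assoc, F.map_ident, G.map_ident]
  map_comp X Y Z := by
    have := G.mul_map (F.map X Y) (F.map Y Z)
    rw [← Category.assoc, F.map_comp]
    exact this

end EnrFunctor

/-- A transformation between enriched functors. -/
@[ext]
structure EnrTrans {W : Type u} [Bicategory.{w, v} W] {C D : EnrCat.{t} W}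
    (F G : EnrFunctor C D) where
  app {a : W} (X : C.Obj a) : 𝟙 a ⟶ D.hom (F.obj X) (G.obj X)
  naturality {a b : W} (X : C.Obj a) (Y : C.Obj b) :
    (ρ_ (C.hom X Y)).inv ≫ D.mul (F.map X Y) (app Y) =
      (λ_ (C.hom X Y)).inv ≫ D.mul (app X) (G.map X Y)

namespace EnrTrans

variable {W : Type u} [Bicategory.{w, v} W] {C D E : EnrCat.{t} W}

/-- The identity transformation. -/
@[simps]
def id (F : EnrFunctor C D) : EnrTrans F F where
  app X := D.ident (F.obj X)
  naturality X Y := by simp [EnrCat.mul_ident, EnrCat.ident_mul]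

/-- Vertical composition of transformations. -/
@[simps]
def comp {F G H : EnrFunctor C D} (α : EnrTrans F G) (β : EnrTrans G H) : EnrTrans F H where
  app {a} X := (λ_ (𝟙 a)).inv ≫ D.mul (α.app X) (β.app X)
  naturality {a b} X Y := by
    have h1 := α.naturality X Y
    have h2 := β.naturality X Y
    rw [← D.whiskerLeft_mul, ← D.whiskerRight_mul]
    have e1 : D.mul (F.map X Y) (D.mul (α.app Y) (β.app Y)) =
        (α_ _ _ _).inv ≫ D.mul (D.mul (F.map X Y) (α.app Y)) (β.app Y) := by
      rw [D.mul_mul]; simp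
    have h1' : D.mul (F.map X Y) (α.app Y) =
      (ρ_ (C.hom X Y)).hom ≫ (λ_ (C.hom X Y)).inv ≫ D.mul (α.app X) (G.map X Y) := by
      rw [← h1]; simp
    have h2' : D.mul (G.map X Y) (β.app Y) =
      (ρ_ (C.hom X Y)).hom ≫ (λ_ (C.hom X Y)).inv ≫ D.mul (β.app X) (H.map X Y) := by
      rw [← h2]; simp
    rw [e1, h1', ← D.whiskerRight_mul, ← D.whiskerRight_mul, D.mul_mul, h2',
      ← D.whiskerLeft_mul, ← D.whiskerLeft_mul]
    rw [D.mul_mul]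
    simp only [← Category.assoc]
    congr 1
    bicategory

instance category : Category (EnrFunctor C D) where
  Hom F G := EnrTrans F G
  id F := id F
  comp α β := comp α β
  id_comp α := by
    apply EnrTrans.ext; funext a X; exact D.unit_ident_mul _
  comp_id α := by
    apply EnrTrans.ext; funext a X; exact D.unit_mul_ident _
  assoc {F G H K} α β γ := by
    apply EnrTrans.ext; funext a X
    simp only [comp_app]
    rw [← D.whiskerRight_mul, ← D.whiskerLeft_mul, D.mul_mul]
    simp

@[ext]
lemma hom_ext {F G : EnrFunctor C D} {α β : F ⟶ G}
    (h : ∀ {a : W} (X : C.Obj a), EnrTrans.app α X = EnrTrans.app β X) : α = β :=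
  EnrTrans.ext (by funext a X; exact h X)

lemma id_app' (F : EnrFunctor C D) {a : W} (X : C.Obj a) :
    EnrTrans.app (𝟙 F) X = D.ident (F.obj X) := rfl

lemma comp_app' {F G H : EnrFunctor C D} (α : F ⟶ G) (β : G ⟶ H) {a : W} (X : C.Obj a) :
    EnrTrans.app (α ≫ β) X = (λ_ (𝟙 a)).inv ≫ D.mul (EnrTrans.app α X) (EnrTrans.app β X) := rfl

/-- Whiskering a transformation with a functor applied first. -/
@[simps]
def whiskerLeft (F : EnrFunctor C D) {G H : EnrFunctor D E} (α : EnrTrans G H) :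
    EnrTrans (F.comp G) (F.comp H) where
  app X := α.app (F.obj X)
  naturality X Y := by
    change (ρ_ (C.hom X Y)).inv ≫ E.mul (X := G.obj (F.obj X)) (Y := G.obj (F.obj Y))
        (F.map X Y ≫ G.map (F.obj X) (F.obj Y)) (α.app (F.obj Y)) =
      (λ_ (C.hom X Y)).inv ≫ E.mul (Y := H.obj (F.obj X)) (Z := H.obj (F.obj Y))
        (α.app (F.obj X)) (F.map X Y ≫ H.map (F.obj X) (F.obj Y))
    rw [← E.whiskerRight_mul, ← E.whiskerLeft_mul, ← rightUnitor_inv_naturality_assoc,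
      α.naturality, leftUnitor_inv_naturality_assoc]

/-- Whiskering a transformation with a functor applied last. -/
@[simps]
def whiskerRight {F G : EnrFunctor C D} (α : EnrTrans F G) (H : EnrFunctor D E) :
    EnrTrans (F.comp H) (G.comp H) where
  app X := α.app X ≫ H.map _ _
  naturality X Y := by
    have h := congrArg (· ≫ H.map _ _) (α.naturality X Y)
    simp only [Category.assoc, H.mul_map] at h
    exact h

/-- Two enriched functors whose actions agree are isomorphic, through identities. -/
@[simps]
def isoOfMap (obj : ∀ {a : W}, C.Obj a → D.Obj a)
    (map map' : ∀ {a b : W} (X : C.Obj a) (Y : C.Obj b), C.hom X Y ⟶ D.hom (obj X) (obj Y))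
    (h₁ h₂ h₁' h₂') (h : ∀ {a b : W} (X : C.Obj a) (Y : C.Obj b), map X Y = map' X Y) :
    (EnrFunctor.mk obj map h₁ h₂ : EnrFunctor C D) ≅ EnrFunctor.mk obj map' h₁' h₂' where
  hom :=
    { app X := D.ident (obj X)
      naturality X Y := by
        simp only [EnrCat.mul_ident, EnrCat.ident_mul, Iso.inv_hom_id_assoc]
        exact h X Y }
  inv :=
    { app X := D.ident (obj X)
      naturality X Y := by
        simp only [EnrCat.mul_ident, EnrCat.ident_mul, Iso.inv_hom_id_assoc]
        exact (h X Y).symm }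
  hom_inv_id := by
    ext a X
    change (λ_ (𝟙 a)).inv ≫ D.mul (D.ident (obj X)) (D.ident (obj X)) = D.ident (obj X)
    exact D.unit_ident_mul _
  inv_hom_id := by
    ext a X
    change (λ_ (𝟙 a)).inv ≫ D.mul (D.ident (obj X)) (D.ident (obj X)) = D.ident (obj X)
    exact D.unit_ident_mul _

lemma isoOfMap_hom_eq (obj : ∀ {a : W}, C.Obj a → D.Obj a)
    (map map' : ∀ {a b : W} (X : C.Obj a) (Y : C.Obj b), C.hom X Y ⟶ D.hom (obj X) (obj Y))
    (h₁ h₂ h₁' h₂') (h : ∀ {a b : W} (X : C.Obj a) (Y : C.Obj b), map X Y = map' X Y) :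
    ∃ e, (isoOfMap obj map map' h₁ h₂ h₁' h₂' h).hom = eqToHom e := by
  obtain rfl : @map = @map' := by
    funext a b X Y
    exact h X Y
  exact ⟨rfl, rfl⟩

lemma isoOfMap_inv_eq (obj : ∀ {a : W}, C.Obj a → D.Obj a)
    (map map' : ∀ {a b : W} (X : C.Obj a) (Y : C.Obj b), C.hom X Y ⟶ D.hom (obj X) (obj Y))
    (h₁ h₂ h₁' h₂') (h : ∀ {a b : W} (X : C.Obj a) (Y : C.Obj b), map X Y = map' X Y) :
    ∃ e, (isoOfMap obj map map' h₁ h₂ h₁' h₂' h).inv = eqToHom e := by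
  obtain rfl : @map = @map' := by
    funext a b X Y
    exact h X Y
  exact ⟨rfl, rfl⟩

end EnrTrans

namespace EnrCat

variable {W : Type u} [Bicategory.{w, v} W]

/-- The `2`-category of categories enriched in `W`. -/
instance bicategory : Bicategory (EnrCat.{t} W) where
  Hom C D := EnrFunctor C D
  id C := EnrFunctor.id C
  comp F G := F.comp G
  homCategory C D := EnrTrans.category
  whiskerLeft F _ _ α := EnrTrans.whiskerLeft F α
  whiskerRight α H := EnrTrans.whiskerRight α H
  associator F G H := EnrTrans.isoOfMap _ _ _ _ _ _ _ (fun X Y => Category.assoc _ _ _)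
  leftUnitor F := EnrTrans.isoOfMap _ _ _ _ _ _ _ (fun X Y => Category.id_comp _)
  rightUnitor F := EnrTrans.isoOfMap _ _ _ _ _ _ _ (fun X Y => Category.comp_id _)
  whiskerLeft_id F G := rfl
  whiskerLeft_comp F _ _ _ α β := rfl
  id_whiskerLeft {C D F G} α := by
    apply EnrTrans.hom_ext; intro a X
    change α.app X = (λ_ (𝟙 a)).inv ≫ D.mul (D.ident _) ((λ_ (𝟙 a)).inv ≫ D.mul (α.app X) (D.ident _))
    rw [D.unit_mul_ident, D.unit_ident_mul]
  comp_whiskerLeft {A B C D} F G H H' α := by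
    apply EnrTrans.hom_ext; intro a X
    change α.app _ = (λ_ (𝟙 a)).inv ≫ D.mul (D.ident _) ((λ_ (𝟙 a)).inv ≫ D.mul (α.app _) (D.ident _))
    rw [D.unit_mul_ident, D.unit_ident_mul]
  id_whiskerRight {C D E} F G := by
    apply EnrTrans.hom_ext; intro a X
    exact G.map_ident _
  comp_whiskerRight {C D E F G H} α β K := by
    apply EnrTrans.hom_ext; intro a X
    change ((λ_ (𝟙 a)).inv ≫ D.mul (α.app X) (β.app X)) ≫ K.map _ _ =
      (λ_ (𝟙 a)).inv ≫ E.mul (α.app X ≫ K.map _ _) (β.app X ≫ K.map _ _)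
    rw [Category.assoc, K.mul_map]
  whiskerRight_id {C D F G} α := by
    apply EnrTrans.hom_ext; intro a X
    change α.app X ≫ 𝟙 _ =
      (λ_ (𝟙 a)).inv ≫ D.mul (D.ident _) ((λ_ (𝟙 a)).inv ≫ D.mul (α.app _) (D.ident _))
    rw [D.unit_mul_ident, D.unit_ident_mul, Category.comp_id]
  whiskerRight_comp {A B C D F F'} α G H := by
    apply EnrTrans.hom_ext; intro a X
    change α.app X ≫ G.map _ _ ≫ H.map _ _ =
      (λ_ (𝟙 a)).inv ≫ D.mul (D.ident _)
        ((λ_ (𝟙 a)).inv ≫ D.mul ((α.app X ≫ G.map _ _) ≫ H.map _ _) (D.ident _))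
    rw [D.unit_mul_ident, D.unit_ident_mul, Category.assoc]
  whisker_assoc {A B C D} F G G' α H := by
    apply EnrTrans.hom_ext; intro a X
    change α.app _ ≫ H.map _ _ =
      (λ_ (𝟙 a)).inv ≫ D.mul (D.ident _)
        ((λ_ (𝟙 a)).inv ≫ D.mul (α.app _ ≫ H.map _ _) (D.ident _))
    rw [D.unit_mul_ident, D.unit_ident_mul]
  whisker_exchange {C D E F G H K} α β := by
    apply EnrTrans.hom_ext; intro a X
    change (λ_ (𝟙 a)).inv ≫ E.mul (β.app (F.obj X)) (α.app X ≫ K.map _ _) =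
      (λ_ (𝟙 a)).inv ≫ E.mul (α.app X ≫ H.map _ _) (β.app (G.obj X))
    have h := β.naturality (F.obj X) (G.obj X)
    rw [← E.whiskerLeft_mul, ← E.whiskerRight_mul, ← leftUnitor_inv_naturality_assoc, ← h,
      rightUnitor_inv_naturality_assoc, unitors_inv_equal]
  pentagon {A B C D E} F G H K := by
    apply EnrTrans.hom_ext; intro a X
    change (λ_ (𝟙 a)).inv ≫ E.mul (D.ident (H.obj (G.obj (F.obj X))) ≫ K.map _ _)
        ((λ_ (𝟙 a)).inv ≫ E.mul (E.ident (K.obj (H.obj (G.obj (F.obj X))))) (E.ident _)) =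
      (λ_ (𝟙 a)).inv ≫ E.mul (E.ident (K.obj (H.obj (G.obj (F.obj X))))) (E.ident _)
    rw [E.unit_ident_mul, E.unit_mul_ident, K.map_ident]
  triangle {C D E} F G := by
    apply EnrTrans.hom_ext; intro a X
    change (λ_ (𝟙 a)).inv ≫ E.mul (E.ident (G.obj (F.obj X))) (E.ident (G.obj (F.obj X))) =
      D.ident (F.obj X) ≫ G.map _ _
    rw [E.unit_ident_mul, G.map_ident]

end EnrCat


section
variable {A B C D : Type w} [SmallCategory A] [SmallCategory B] [SmallCategory C] [SmallCategory D]

/-- Functors `Aᵒᵖ ⥤ FL(B, Set)`. -/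
abbrev LexProfunctor (A B : Type w) [SmallCategory A] [SmallCategory B] : Type (w + 1) :=
  Aᵒᵖ ⥤ (B ⥤ₗ Type w)

namespace LexProfunctor

/-- The set `M(a, b)`. -/
abbrev el (M : LexProfunctor A B) (a : A) (b : B) : Type w := (M.obj (op a)).obj.obj b

/-- The contravariant action `M(f, b)`. -/
def lact (M : LexProfunctor A B) {a a' : A} (f : a' ⟶ a) {b : B} (m : M.el a b) : M.el a' b :=
  (M.map f.op).hom.app b m

/-- The covariant action `M(a, g)`. -/
def ract (M : LexProfunctor A B) {a : A} {b b' : B} (g : b ⟶ b') (m : M.el a b) : M.el a b' :=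
  (M.obj (op a)).obj.map g m

section
variable (M : LexProfunctor A B)

@[simp] lemma lact_id {a : A} {b : B} (m : M.el a b) : M.lact (𝟙 a) m = m := by
  simp [lact]

@[simp] lemma ract_id {a : A} {b : B} (m : M.el a b) : M.ract (𝟙 b) m = m := by
  simp [ract]

lemma lact_comp {a a' a'' : A} (f : a' ⟶ a) (f' : a'' ⟶ a') {b : B} (m : M.el a b) :
    M.lact (f' ≫ f) m = M.lact f' (M.lact f m) := by
  simp [lact]

lemma ract_comp {a : A} {b b' b'' : B} (g : b ⟶ b') (g' : b' ⟶ b'') (m : M.el a b) :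
    M.ract (g ≫ g') m = M.ract g' (M.ract g m) := by
  simp [ract]

lemma lact_ract {a a' : A} (f : a' ⟶ a) {b b' : B} (g : b ⟶ b') (m : M.el a b) :
    M.lact f (M.ract g m) = M.ract g (M.lact f m) := by
  simp only [lact, ract]
  exact ConcreteCategory.congr_hom ((M.map f.op).hom.naturality g) m

end

/-- The component of a morphism of lex profunctors. -/
def app {M N : LexProfunctor A B} (φ : M ⟶ N) {a : A} {b : B} (m : M.el a b) : N.el a b :=
  (NatTrans.app φ (op a)).hom.app b m

lemma app_lact {M N : LexProfunctor A B} (φ : M ⟶ N) {a a' : A} (f : a' ⟶ a) {b : B}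
    (m : M.el a b) : app φ (M.lact f m) = N.lact f (app φ m) := by
  have := congrArg (fun k => k.hom.app b) (φ.naturality f.op)
  exact ConcreteCategory.congr_hom this m

lemma app_ract {M N : LexProfunctor A B} (φ : M ⟶ N) {a : A} {b b' : B} (g : b ⟶ b')
    (m : M.el a b) : app φ (M.ract g m) = N.ract g (app φ m) :=
  ConcreteCategory.congr_hom ((NatTrans.app φ (op a)).hom.naturality g) m

lemma hom_ext {M N : LexProfunctor A B} {φ ψ : M ⟶ N}
    (h : ∀ {a : A} {b : B} (m : M.el a b), app φ m = app ψ m) : φ = ψ := by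
  apply NatTrans.ext
  funext a
  apply ObjectProperty.hom_ext
  apply NatTrans.ext
  funext b
  ext m
  exact h m

@[simp] lemma app_id (M : LexProfunctor A B) {a : A} {b : B} (m : M.el a b) :
    app (𝟙 M) m = m := rfl

@[simp] lemma app_comp {M N P : LexProfunctor A B} (φ : M ⟶ N) (ψ : N ⟶ P) {a : A} {b : B}
    (m : M.el a b) : app (φ ≫ ψ) m = app ψ (app φ m) := rfl

/-- Construct a morphism of lex profunctors from a family of functions natural in both variables. -/
def mkHom {M N : LexProfunctor A B} (f : ∀ {a : A} {b : B}, M.el a b → N.el a b)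
    (hl : ∀ {a a' : A} (u : a' ⟶ a) {b : B} (m : M.el a b), f (M.lact u m) = N.lact u (f m))
    (hr : ∀ {a : A} {b b' : B} (g : b ⟶ b') (m : M.el a b), f (M.ract g m) = N.ract g (f m)) :
    M ⟶ N where
  app a := ObjectProperty.homMk
    { app b := ↾(fun m => f (a := a.unop) m)
      naturality b b' g := by ext m; exact hr g m }
  naturality a a' u := by
    apply ObjectProperty.hom_ext
    apply NatTrans.ext
    funext b
    ext m
    exact hl u.unop m

@[simp] lemma app_mkHom {M N : LexProfunctor A B} (f : ∀ {a : A} {b : B}, M.el a b → N.el a b)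
    (hl hr) {a : A} {b : B} (m : M.el a b) : app (mkHom (M := M) (N := N) f hl hr) m = f m := rfl

end LexProfunctor

section Coend

/-- The relation generating the coend `∫^b N(b, c) × X(b)`. -/
inductive CoendRel (X : B ⥤ Type w) (N : LexProfunctor B C) (c : C) :
    (Σ b : B, X.obj b × N.el b c) → (Σ b : B, X.obj b × N.el b c) → Prop
  | mk {b b' : B} (f : b ⟶ b') (x : X.obj b) (n : N.el b' c) :
    CoendRel X N c ⟨b, x, N.lact f n⟩ ⟨b', X.map f x, n⟩

/-- The coend `∫^b N(b, c) × X(b)`. -/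
def CoendObj (X : B ⥤ Type w) (N : LexProfunctor B C) (c : C) : Type w := Quot (CoendRel X N c)

/-- The class of a pair in the coend. -/
def CoendObj.mk {X : B ⥤ Type w} {N : LexProfunctor B C} {c : C} {b : B} (x : X.obj b)
    (n : N.el b c) : CoendObj X N c := Quot.mk _ ⟨b, x, n⟩

lemma CoendObj.sound {X : B ⥤ Type w} {N : LexProfunctor B C} {c : C} {b b' : B} (f : b ⟶ b')
    (x : X.obj b) (n : N.el b' c) :
    (CoendObj.mk x (N.lact f n) : CoendObj X N c) = CoendObj.mk (X.map f x) n :=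
  Quot.sound (.mk f x n)

lemma CoendObj.ind {X : B ⥤ Type w} {N : LexProfunctor B C} {c : C}
    {p : CoendObj X N c → Prop} (h : ∀ {b : B} (x : X.obj b) (n : N.el b c), p (.mk x n)) (q) :
    p q := Quot.ind (fun ⟨_, x, n⟩ => h x n) q

/-- Descent of a dinatural family to the coend. -/
def CoendObj.lift {X : B ⥤ Type w} {N : LexProfunctor B C} {c : C} {T : Type w}
    (f : ∀ {b : B} (_ : X.obj b) (_ : N.el b c), T)
    (h : ∀ {b b' : B} (u : b ⟶ b') (x : X.obj b) (n : N.el b' c),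
      f x (N.lact u n) = f (X.map u x) n) (q : CoendObj X N c) : T :=
  Quot.lift (fun p => f p.2.1 p.2.2) (by rintro _ _ ⟨u, x, n⟩; exact h u x n) q

@[simp] lemma CoendObj.lift_mk {X : B ⥤ Type w} {N : LexProfunctor B C} {c : C} {T : Type w}
    (f : ∀ {b : B} (_ : X.obj b) (_ : N.el b c), T) (h) {b : B} (x : X.obj b) (n : N.el b c) :
    CoendObj.lift (X := X) (N := N) f h (.mk x n) = f x n := rfl

/-- The functor `c ↦ ∫^b N(b, c) × X(b)`. -/
@[simps]
def coendFunctor (X : B ⥤ Type w) (N : LexProfunctor B C) : C ⥤ Type w where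
  obj c := CoendObj X N c
  map {c c'} g := ↾(CoendObj.lift (fun x n => .mk x (N.ract g n))
    (fun u x n => by rw [← N.lact_ract, CoendObj.sound]))
  map_id c := by
    ext q
    induction q using CoendObj.ind with | h x n => simp
  map_comp g g' := by
    ext q
    induction q using CoendObj.ind with | h x n => simp [N.ract_comp]

/-- The diagram of functors `N(b, -)` indexed by the elements of `X`. -/
def elemDiagram (X : B ⥤ Type w) (N : LexProfunctor B C) : C ⥤ (X.Elementsᵒᵖ ⥤ Type w) :=
  ((CategoryOfElements.π X).op ⋙ N ⋙ LeftExactFunctor.forget C (Type w)).flip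

/-- The coend as a colimit over the elements of `X`. -/
def coendCocone (X : B ⥤ Type w) (N : LexProfunctor B C) (c : C) :
    Cocone ((elemDiagram X N).obj c) where
  pt := CoendObj X N c
  ι :=
    { app e := ↾(fun n => CoendObj.mk e.unop.2 n)
      naturality e e' f := by
        ext n
        refine (CoendObj.sound (X := X) (N := N) f.unop.1 e'.unop.2 n).trans ?_
        exact congrArg (fun y => CoendObj.mk y n) f.unop.2 }

/-- The coend is a colimit over the elements of `X`. -/
def coendIsColimit (X : B ⥤ Type w) (N : LexProfunctor B C) (c : C) :
    IsColimit (coendCocone X N c) where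
  desc s := ↾(CoendObj.lift (fun {b} x n => s.ι.app (op ⟨b, x⟩) n) (fun {b b'} u x n => by
    exact ConcreteCategory.congr_hom (s.w
      (CategoryOfElements.homMk ⟨b, x⟩ ⟨b', X.map u x⟩ u rfl).op) n))
  fac s e := by ext n; rfl
  uniq s m hm := by
    ext q
    induction q using CoendObj.ind with | @h b x n => 
    exact ConcreteCategory.congr_hom (hm (op ⟨b, x⟩)) n

lemma elemDiagram_preservesFiniteLimits (X : B ⥤ Type w) (N : LexProfunctor B C) :
    PreservesFiniteLimits (elemDiagram X N) where
  preservesFiniteLimits J _ _ := by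
    refine ⟨fun {K} => ?_⟩
    refine preservesLimit_of_evaluation _ _ (fun e => ?_)
    have : PreservesFiniteLimits (N.obj (op e.unop.1)).obj := (N.obj (op e.unop.1)).property
    change PreservesLimit K (N.obj (op e.unop.1)).obj
    infer_instance

/-- The coend as a colimit, naturally. -/
noncomputable def coendIso (X : B ⥤ Type w) (N : LexProfunctor B C) :
    elemDiagram X N ⋙ colim ≅ coendFunctor X N :=
  NatIso.ofComponents
    (fun c => (colimit.isColimit _).coconePointUniqueUpToIso (coendIsColimit X N c))
    (fun {c c'} g => by
      refine colimit.hom_ext (fun e => ?_)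
      have h1 : ∀ c, colimit.ι ((elemDiagram X N).obj c) e ≫
          ((colimit.isColimit _).coconePointUniqueUpToIso (coendIsColimit X N c)).hom =
            (coendCocone X N c).ι.app e := fun c =>
        IsColimit.comp_coconePointUniqueUpToIso_hom (colimit.isColimit _) (coendIsColimit X N c) e
      have h2 : colimit.ι ((elemDiagram X N).obj c) e ≫ colim.map ((elemDiagram X N).map g) =
          ((elemDiagram X N).map g).app e ≫ colimit.ι ((elemDiagram X N).obj c') e :=
        ι_colimMap _ _
      have h3 : ((elemDiagram X N).map g).app e ≫ (coendCocone X N c').ι.app e =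
          (coendCocone X N c).ι.app e ≫ (coendFunctor X N).map g := rfl
      exact (Category.assoc _ _ _).symm.trans ((congrArg (· ≫ _) h2).trans
        ((Category.assoc _ _ _).trans ((congrArg (_ ≫ ·) (h1 c')).trans
          (h3.trans ((congrArg (· ≫ _) (h1 c).symm).trans (Category.assoc _ _ _)))))))

lemma coendFunctor_preservesFiniteLimits [HasFiniteLimits B] (X : B ⥤ Type w)
    [PreservesFiniteLimits X] (N : LexProfunctor B C) :
    PreservesFiniteLimits (coendFunctor X N) := by
  have := elemDiagram_preservesFiniteLimits X N
  have : HasFiniteLimits X.Elements := ⟨fun J _ _ => inferInstance⟩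
  have : IsCofiltered X.Elements := IsCofiltered.of_hasFiniteLimits _
  have : PreservesFiniteLimits (elemDiagram X N ⋙ colim) := comp_preservesFiniteLimits _ _
  exact preservesFiniteLimits_of_natIso (coendIso X N)

end Coend

namespace LexProfunctor

/-- The identity lex profunctor `I(a', a) = A(a', a)`. -/
def one (A : Type w) [SmallCategory A] : LexProfunctor A A where
  obj a := ⟨coyoneda.obj a, by rw [leftExactFunctor_iff]; infer_instance⟩
  map f := ObjectProperty.homMk (coyoneda.map f)

/-- The composite lex profunctor `(N ⊗ M)(a, c) = ∫^b N(b, c) × M(a, b)`. -/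
def tensor [HasFiniteLimits B] (M : LexProfunctor A B) (N : LexProfunctor B C) :
    LexProfunctor A C where
  obj a := ⟨coendFunctor (M.obj a).obj N, by
    have : PreservesFiniteLimits (M.obj a).obj := (M.obj a).property
    exact coendFunctor_preservesFiniteLimits _ _⟩
  map {a a'} f := ObjectProperty.homMk
    { app c := ↾(CoendObj.lift (fun m n => .mk ((M.map f).hom.app _ m) n) (fun u m n => by
        rw [CoendObj.sound]
        congr 1
        exact (ConcreteCategory.congr_hom ((M.map f).hom.naturality u) m).symm))
      naturality c c' g := by
        ext q
        induction q using CoendObj.ind with | h m n => rfl }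
  map_id a := by
    apply ObjectProperty.hom_ext
    apply NatTrans.ext
    funext c
    ext q
    induction q using CoendObj.ind with | h m n => 
    change CoendObj.mk _ _ = CoendObj.mk _ _
    simp
  map_comp f f' := by
    apply ObjectProperty.hom_ext
    apply NatTrans.ext
    funext c
    ext q
    induction q using CoendObj.ind with | h m n => 
    change CoendObj.mk _ _ = CoendObj.mk _ _
    simp

section
variable [HasFiniteLimits B]

/-- The class of `(n, m)` in `(N ⊗ M)(a, c)`. -/
def tmul {M : LexProfunctor A B} {N : LexProfunctor B C} {a : A} {b : B} {c : C} (m : M.el a b)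
    (n : N.el b c) : (M.tensor N).el a c := CoendObj.mk m n

lemma tmul_lact {M : LexProfunctor A B} {N : LexProfunctor B C} {a : A} {b b' : B} {c : C}
    (f : b ⟶ b') (m : M.el a b) (n : N.el b' c) :
    (tmul m (N.lact f n) : (M.tensor N).el a c) = tmul (M.ract f m) n :=
  CoendObj.sound f m n

lemma tensor_ind {M : LexProfunctor A B} {N : LexProfunctor B C} {a : A} {c : C}
    {p : (M.tensor N).el a c → Prop}
    (h : ∀ {b : B} (m : M.el a b) (n : N.el b c), p (tmul m n)) (q) : p q :=
  CoendObj.ind (fun m n => h m n) q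

@[simp] lemma lact_tmul {M : LexProfunctor A B} {N : LexProfunctor B C} {a a' : A} {b : B} {c : C}
    (f : a' ⟶ a) (m : M.el a b) (n : N.el b c) :
    (M.tensor N).lact f (tmul m n) = tmul (M.lact f m) n := rfl

@[simp] lemma ract_tmul {M : LexProfunctor A B} {N : LexProfunctor B C} {a : A} {b : B} {c c' : C}
    (g : c ⟶ c') (m : M.el a b) (n : N.el b c) :
    (M.tensor N).ract g (tmul m n) = tmul m (N.ract g n) := rfl

/-- Descent of a dinatural family to a value of a composite lex profunctor. -/
def tensorRec {M : LexProfunctor A B} {N : LexProfunctor B C} {a : A} {c : C} {T : Type w}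
    (f : ∀ {b : B}, M.el a b → N.el b c → T)
    (h : ∀ {b b' : B} (u : b ⟶ b') (m : M.el a b) (n : N.el b' c),
      f m (N.lact u n) = f (M.ract u m) n) (q : (M.tensor N).el a c) : T :=
  CoendObj.lift (fun m n => f m n) (fun u m n => h u m n) q

@[simp] lemma tensorRec_tmul {M : LexProfunctor A B} {N : LexProfunctor B C} {a : A} {c : C}
    {T : Type w} (f : ∀ {b : B}, M.el a b → N.el b c → T) (h) {b : B} (m : M.el a b)
    (n : N.el b c) : tensorRec f h (tmul m n) = f m n := rfl

/-- Morphisms out of a composite lex profunctor are families natural in the outer variables and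
dinatural in the middle variable. -/
def tensorDesc {M : LexProfunctor A B} {N : LexProfunctor B C} {P : LexProfunctor A C}
    (f : ∀ {a : A} {b : B} {c : C}, M.el a b → N.el b c → P.el a c)
    (hl : ∀ {a a' : A} {b : B} {c : C} (u : a' ⟶ a) (m : M.el a b) (n : N.el b c),
      f (M.lact u m) n = P.lact u (f m n))
    (hm : ∀ {a : A} {b b' : B} {c : C} (u : b ⟶ b') (m : M.el a b) (n : N.el b' c),
      f m (N.lact u n) = f (M.ract u m) n)
    (hr : ∀ {a : A} {b : B} {c c' : C} (u : c ⟶ c') (m : M.el a b) (n : N.el b c),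
      f m (N.ract u n) = P.ract u (f m n)) : M.tensor N ⟶ P :=
  mkHom (tensorRec f hm)
    (fun u b q => by
      induction q using tensor_ind with | h m n => exact hl u m n)
    (fun u q => by
      induction q using tensor_ind with | h m n => exact hr u m n)

@[simp] lemma app_tensorDesc {M : LexProfunctor A B} {N : LexProfunctor B C}
    {P : LexProfunctor A C} (f : ∀ {a : A} {b : B} {c : C}, M.el a b → N.el b c → P.el a c)
    (hl hm hr) {a : A} {b : B} {c : C} (m : M.el a b) (n : N.el b c) :
    app (tensorDesc (P := P) f hl hm hr) (tmul m n) = f m n := rfl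

lemma tensor_hom_ext {M : LexProfunctor A B} {N : LexProfunctor B C} {P : LexProfunctor A C}
    {φ ψ : M.tensor N ⟶ P}
    (h : ∀ {a : A} {b : B} {c : C} (m : M.el a b) (n : N.el b c),
      app φ (tmul m n) = app ψ (tmul m n)) : φ = ψ :=
  hom_ext (fun q => by induction q using tensor_ind with | h m n => exact h m n)

/-- Left whiskering. -/
def whiskL (M : LexProfunctor A B) {N N' : LexProfunctor B C} (φ : N ⟶ N') :
    M.tensor N ⟶ M.tensor N' :=
  tensorDesc (fun m n => tmul m (app φ n)) (fun u m n => by simp)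
    (fun u m n => by rw [app_lact, tmul_lact]) (fun u m n => by simp [app_ract])

/-- Right whiskering. -/
def whiskR {M M' : LexProfunctor A B} (φ : M ⟶ M') (N : LexProfunctor B C) :
    M.tensor N ⟶ M'.tensor N :=
  tensorDesc (fun m n => tmul (app φ m) n) (fun u m n => by simp [app_lact])
    (fun u m n => by rw [app_ract, tmul_lact]) (fun u m n => by simp)

@[simp] lemma app_whiskL (M : LexProfunctor A B) {N N' : LexProfunctor B C} (φ : N ⟶ N')
    {a : A} {b : B} {c : C} (m : M.el a b) (n : N.el b c) :
    app (whiskL M φ) (tmul m n) = tmul m (app φ n) := rfl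

@[simp] lemma app_whiskR {M M' : LexProfunctor A B} (φ : M ⟶ M') (N : LexProfunctor B C)
    {a : A} {b : B} {c : C} (m : M.el a b) (n : N.el b c) :
    app (whiskR φ N) (tmul m n) = tmul (app φ m) n := rfl

end

section
variable [HasFiniteLimits B] [HasFiniteLimits C]

/-- The associator. -/
def assocIso (M : LexProfunctor A B) (N : LexProfunctor B C) (P : LexProfunctor C D) :
    (M.tensor N).tensor P ≅ M.tensor (N.tensor P) where
  hom := tensorDesc
    (fun q p => tensorRec (fun m n => tmul m (tmul n p))
      (fun u m n => by rw [← tmul_lact, lact_tmul]) q)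
    (fun u q p => by induction q using tensor_ind with | h m n => rfl)
    (fun u q p => by
      induction q using tensor_ind with | h m n => simp only [tensorRec_tmul, ract_tmul, tmul_lact])
    (fun u q p => by induction q using tensor_ind with | h m n => rfl)
  inv := tensorDesc
    (fun m q => tensorRec (fun n p => tmul (tmul m n) p)
      (fun u n p => by rw [tmul_lact, ract_tmul]) q)
    (fun u m q => by induction q using tensor_ind with | h n p => rfl)
    (fun u m q => by
      induction q using tensor_ind with | h n p => simp only [tensorRec_tmul, lact_tmul, tmul_lact])
    (fun u m q => by induction q using tensor_ind with | h n p => rfl)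
  hom_inv_id := tensor_hom_ext (fun q p => by
    induction q using tensor_ind with | h m n => rfl)
  inv_hom_id := tensor_hom_ext (fun m q => by
    induction q using tensor_ind with | h n p => rfl)

end

/-- A morphism as an element of the identity lex profunctor. -/
def ofHom {a b : A} (f : a ⟶ b) : (one A).el a b := f

lemma lact_ofHom {a' a b : A} (u : a' ⟶ a) (f : a ⟶ b) :
    (one A).lact u (ofHom f) = ofHom (u ≫ f) := rfl

lemma ract_ofHom {a b b' : A} (f : a ⟶ b) (u : b ⟶ b') :
    (one A).ract u (ofHom f) = ofHom (f ≫ u) := rfl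

lemma ofHom_tmul [HasFiniteLimits A] (M : LexProfunctor A B) {a a' : A} {b : B} (f : a ⟶ a')
    (m : M.el a' b) :
    (tmul (ofHom (𝟙 a)) (M.lact f m) : ((one A).tensor M).el a b) = tmul (ofHom f) m := by
  rw [tmul_lact, ract_ofHom, Category.id_comp]

lemma tmul_ofHom [HasFiniteLimits B] (M : LexProfunctor A B) {a : A} {b b' : B} (f : b ⟶ b')
    (m : M.el a b) :
    (tmul (M.ract f m) (ofHom (𝟙 b')) : (M.tensor (one B)).el a b') = tmul m (ofHom f) := by
  rw [← tmul_lact, lact_ofHom, Category.comp_id]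

/-- The left unitor. -/
def leftUnitIso [HasFiniteLimits A] (M : LexProfunctor A B) : (one A).tensor M ≅ M where
  hom := tensorDesc (fun f m => M.lact f m) (fun u f m => M.lact_comp f u m)
    (fun u f m => (M.lact_comp u f m).symm) (fun u f m => M.lact_ract f u m)
  inv := mkHom (fun {a b} m => tmul (ofHom (𝟙 a)) m)
    (fun u b m => by
      rw [ofHom_tmul, lact_tmul, lact_ofHom, Category.comp_id])
    (fun u m => rfl)
  hom_inv_id := tensor_hom_ext (fun f m => ofHom_tmul M f m)
  inv_hom_id := hom_ext (fun m => M.lact_id m)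

/-- The right unitor. -/
def rightUnitIso [HasFiniteLimits B] (M : LexProfunctor A B) : M.tensor (one B) ≅ M where
  hom := tensorDesc (fun m f => M.ract f m) (fun u m f => (M.lact_ract u f m).symm)
    (fun u m f => M.ract_comp u f m) (fun u m f => M.ract_comp f u m)
  inv := mkHom (fun {a b} m => tmul m (ofHom (𝟙 b)))
    (fun u b m => rfl)
    (fun u m => by
      rw [tmul_ofHom, ract_tmul, ract_ofHom, Category.id_comp])
  hom_inv_id := tensor_hom_ext (fun m f => tmul_ofHom M f m)
  inv_hom_id := hom_ext (fun m => M.ract_id m)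

end LexProfunctor

end

/-- The objects of the bicategory of lex profunctors: small categories with finite limits. -/
structure LexProf : Type (w + 1) where
  carrier : Type w
  [cat : SmallCategory carrier]
  [hasFiniteLimits : HasFiniteLimits carrier]

attribute [instance] LexProf.cat LexProf.hasFiniteLimits

namespace LexProf

open LexProfunctor

/-- The bicategory of lex profunctors. -/
instance bicategory : Bicategory LexProf.{w} where
  Hom A B := LexProfunctor A.carrier B.carrier
  id A := one A.carrier
  comp M N := M.tensor N
  homCategory A B := inferInstance
  whiskerLeft M _ _ φ := whiskL M φ
  whiskerRight φ N := whiskR φ N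
  associator M N P := assocIso M N P
  leftUnitor M := leftUnitIso M
  rightUnitor M := rightUnitIso M
  whiskerLeft_id M N := tensor_hom_ext (fun m n => rfl)
  whiskerLeft_comp M _ _ _ φ ψ := tensor_hom_ext (fun m n => rfl)
  id_whiskerLeft φ := tensor_hom_ext (fun f m =>
    ((ofHom_tmul _ f _).symm.trans (congrArg (tmul _) (app_lact φ f m).symm)))
  comp_whiskerLeft M N _ _ φ := tensor_hom_ext (fun q p => by
    induction q using tensor_ind with | h m n => rfl)
  id_whiskerRight M N := tensor_hom_ext (fun m n => rfl)
  comp_whiskerRight φ ψ N := tensor_hom_ext (fun m n => rfl)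
  whiskerRight_id φ := tensor_hom_ext (fun m f =>
    ((tmul_ofHom _ f _).symm.trans (congrArg (tmul · _) (app_ract φ f m).symm)))
  whiskerRight_comp φ N P := tensor_hom_ext (fun m q => by
    induction q using tensor_ind with | h n p => rfl)
  whisker_assoc M _ _ φ P := tensor_hom_ext (fun q p => by
    induction q using tensor_ind with | h m n => rfl)
  whisker_exchange φ ψ := tensor_hom_ext (fun m n => rfl)
  pentagon M N P Q := tensor_hom_ext (fun q p => by
    induction q using tensor_ind with | h q n => 
    induction q using tensor_ind with | h m n => rfl)
  triangle M N := tensor_hom_ext (fun q n => by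
    induction q using tensor_ind with | h m f => exact tmul_lact f m n)

end LexProf

namespace EnrCat

section Tensors

variable {W : Type u} [Bicategory.{w, v} W]

/-- The map `τ : P ⟶ C(X, PX)` exhibits `PX` as the tensor of `X` by the `1`-cell `P`. -/
def IsTensor (C : EnrCat.{t} W) {x y : W} (P : x ⟶ y) (X : C.Obj x) (PX : C.Obj y)
    (τ : P ⟶ C.hom X PX) : Prop :=
  ∀ ⦃z : W⦄ (U : y ⟶ z) (Z : C.Obj z),
    Function.Bijective (fun f : U ⟶ C.hom PX Z => (C.mul τ f : P ≫ U ⟶ C.hom X Z))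

/-- An enriched category is tensored if it admits all tensors. -/
def IsTensored (C : EnrCat.{t} W) : Prop :=
  ∀ ⦃x y : W⦄ (P : x ⟶ y) (X : C.Obj x),
    ∃ (PX : C.Obj y) (τ : P ⟶ C.hom X PX), C.IsTensor P X PX τ

end Tensors

section Single

variable {W : Type u} [Bicategory.{w, v} W]

/-- A monad on the object `x` of the bicategory `W`. -/
structure MonadOn (x : W) where
  T : x ⟶ x
  unit : 𝟙 x ⟶ T
  mul : T ≫ T ⟶ T
  assoc : mul ▷ T ≫ mul = (α_ T T T).hom ≫ T ◁ mul ≫ mul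
  unit_mul : unit ▷ T ≫ mul = (λ_ T).hom
  mul_unit : T ◁ unit ≫ mul = (ρ_ T).hom

/-- A map of monads on `x`. -/
structure MonadOn.Map {x : W} (S T : MonadOn x) where
  map : S.T ⟶ T.T
  unit_map : S.unit ≫ map = T.unit
  mul_map : S.mul ≫ map = (map ▷ S.T ≫ T.T ◁ map) ≫ T.mul

/-- The family of objects of an enriched category with a single object, of extent `x`. -/
inductive Single (x : W) : W → Type t
  | star : Single x x

/-- The one-object enriched category given by a monad on `x` in `W`. -/
def single {x : W} (T : MonadOn x) : EnrCat.{t} W where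
  Obj := Single x
  hom X Y := match X, Y with
    | .star, .star => T.T
  comp X Y Z := match X, Y, Z with
    | .star, .star, .star => T.mul
  ident X := match X with
    | .star => T.unit
  assoc X Y Z Z' := match X, Y, Z, Z' with
    | .star, .star, .star, .star => T.assoc
  ident_comp X Y := match X, Y with
    | .star, .star => T.unit_mul
  comp_ident X Y := match X, Y with
    | .star, .star => T.mul_unit

/-- The enriched functor between one-object enriched categories given by a map of monads. -/
def singleMap {x : W} {S T : MonadOn x} (φ : S.Map T) :
    EnrFunctor (single.{t} S) (single T) where
  obj X := X
  map X Y := match X, Y with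
    | .star, .star => φ.map
  map_ident X := match X with
    | .star => φ.unit_map
  map_comp X Y Z := match X, Y, Z with
    | .star, .star, .star => φ.mul_map

/-- The functor given by the identity map of monads is isomorphic, through identities, to the
identity functor. -/
def singleMapId {x : W} {S : MonadOn x} (φ : S.Map S) (h : φ.map = 𝟙 S.T) :
    singleMap.{t} φ ≅ EnrFunctor.id (single S) :=
  EnrTrans.isoOfMap _ _ _ _ _ _ _ (fun X Y => match X, Y with
    | .star, .star => h)

/-- The functor given by a composite of maps of monads is isomorphic, through identities, to the
composite of the functors. -/
def singleMapComp {x : W} {S T R : MonadOn x} (φ : S.Map T) (ψ : T.Map R) (χ : S.Map R)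
    (h : χ.map = φ.map ≫ ψ.map) :
    singleMap.{t} χ ≅ (singleMap φ).comp (singleMap ψ) :=
  EnrTrans.isoOfMap _ _ _ _ _ _ _ (fun X Y => match X, Y with
    | .star, .star => h)

end Single

end EnrCat

/-- A `2`-cell of a bicategory that is an identity, up to an equality of `1`-cells. -/
def IsEqTwoCell {B : Type*} [Bicategory B] {x y : B} {f g : x ⟶ y} (α : f ⟶ g) : Prop :=
  ∃ e : f = g, α = eqToHom e

namespace IsEqTwoCell

variable {B : Type*} [Bicategory B] {x y z : B}

lemma comp {f g h : x ⟶ y} {α : f ⟶ g} {β : g ⟶ h} (hα : IsEqTwoCell α) (hβ : IsEqTwoCell β) :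
    IsEqTwoCell (α ≫ β) := by
  obtain ⟨rfl, rfl⟩ := hα
  obtain ⟨rfl, rfl⟩ := hβ
  exact ⟨rfl, by simp⟩

lemma whiskerLeft (f : x ⟶ y) {g h : y ⟶ z} {α : g ⟶ h} (hα : IsEqTwoCell α) :
    IsEqTwoCell (f ◁ α) := by
  obtain ⟨rfl, rfl⟩ := hα
  exact ⟨rfl, by simp⟩

lemma whiskerRight {f g : x ⟶ y} {α : f ⟶ g} (hα : IsEqTwoCell α) (h : y ⟶ z) :
    IsEqTwoCell (α ▷ h) := by
  obtain ⟨rfl, rfl⟩ := hα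
  exact ⟨rfl, by simp⟩

open Bicategory.Opposite in
lemma op2 {f g : x ⟶ y} {α : f ⟶ g} (hα : IsEqTwoCell α) : IsEqTwoCell (op2 α) := by
  obtain ⟨rfl, rfl⟩ := hα
  exact ⟨rfl, rfl⟩

lemma eq {f g : x ⟶ y} {α : f ⟶ g} (hα : IsEqTwoCell α) (e : f = g) : α = eqToHom e := by
  obtain ⟨_, rfl⟩ := hα
  rfl

end IsEqTwoCell

namespace EnrCat

variable {W : Type u} [Bicategory.{w, v} W] {C D E F : EnrCat.{t} W}

lemma isEqTwoCell_associator (f : C ⟶ D) (g : D ⟶ E) (h : E ⟶ F) :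
    IsEqTwoCell (α_ f g h).hom ∧ IsEqTwoCell (α_ f g h).inv :=
  ⟨EnrTrans.isoOfMap_hom_eq _ _ _ _ _ _ _ (fun _ _ => Category.assoc _ _ _),
    EnrTrans.isoOfMap_inv_eq _ _ _ _ _ _ _ (fun _ _ => Category.assoc _ _ _)⟩

lemma isEqTwoCell_leftUnitor (f : C ⟶ D) :
    IsEqTwoCell (λ_ f).hom ∧ IsEqTwoCell (λ_ f).inv :=
  ⟨EnrTrans.isoOfMap_hom_eq _ _ _ _ _ _ _ (fun _ _ => Category.id_comp _),
    EnrTrans.isoOfMap_inv_eq _ _ _ _ _ _ _ (fun _ _ => Category.id_comp _)⟩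

lemma isEqTwoCell_rightUnitor (f : C ⟶ D) :
    IsEqTwoCell (ρ_ f).hom ∧ IsEqTwoCell (ρ_ f).inv :=
  ⟨EnrTrans.isoOfMap_hom_eq _ _ _ _ _ _ _ (fun _ _ => Category.comp_id _),
    EnrTrans.isoOfMap_inv_eq _ _ _ _ _ _ _ (fun _ _ => Category.comp_id _)⟩

variable {x : W}

lemma isEqTwoCell_singleMapId {S : MonadOn x} (φ : S.Map S) (h : φ.map = 𝟙 S.T) :
    IsEqTwoCell (f := singleMap.{t} φ) (g := 𝟙 (single.{t} S)) (singleMapId.{t} φ h).hom ∧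
      IsEqTwoCell (f := 𝟙 (single.{t} S)) (g := singleMap.{t} φ) (singleMapId.{t} φ h).inv :=
  ⟨EnrTrans.isoOfMap_hom_eq _ _ _ _ _ _ _ (by
      rintro _ _ ⟨⟩ ⟨⟩
      exact h),
    EnrTrans.isoOfMap_inv_eq _ _ _ _ _ _ _ (by
      rintro _ _ ⟨⟩ ⟨⟩
      exact h)⟩

lemma isEqTwoCell_singleMapComp {S T R : MonadOn x} (φ : S.Map T) (ψ : T.Map R) (χ : S.Map R)
    (h : χ.map = φ.map ≫ ψ.map) :
    IsEqTwoCell (B := EnrCat.{t} W) (x := single.{t} S) (y := single.{t} R)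
        (f := singleMap.{t} χ) (g := (singleMap.{t} φ).comp (singleMap.{t} ψ))
        (singleMapComp.{t} φ ψ χ h).hom ∧
      IsEqTwoCell (B := EnrCat.{t} W) (x := single.{t} S) (y := single.{t} R)
        (f := (singleMap.{t} φ).comp (singleMap.{t} ψ)) (g := singleMap.{t} χ)
        (singleMapComp.{t} φ ψ χ h).inv :=
  ⟨EnrTrans.isoOfMap_hom_eq _ _ _ _ _ _ _ (by
      rintro _ _ ⟨⟩ ⟨⟩
      exact h),
    EnrTrans.isoOfMap_inv_eq _ _ _ _ _ _ _ (by
      rintro _ _ ⟨⟩ ⟨⟩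
      exact h)⟩

end EnrCat

open LexProfunctor

/-- The lex profunctor `(a, b) ↦ Set(X a, Y b)`. -/
def setHom {A B : Type w} [SmallCategory A] [SmallCategory B] (X : A ⥤ₗ Type w)
    (Y : B ⥤ₗ Type w) : LexProfunctor A B where
  obj a := ⟨Y.obj ⋙ coyoneda.obj (op (X.obj.obj a.unop)), by
    have : PreservesFiniteLimits Y.obj := Y.property
    rw [leftExactFunctor_iff]
    exact comp_preservesFiniteLimits _ _⟩
  map f := ObjectProperty.homMk (Functor.whiskerLeft Y.obj (coyoneda.map (X.obj.map f.unop).op))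
  map_id a := by
    apply ObjectProperty.hom_ext
    apply NatTrans.ext
    funext b
    simp
  map_comp f g := by
    apply ObjectProperty.hom_ext
    apply NatTrans.ext
    funext b
    simp

/-- The tensored enriched category whose objects of extent `A` are the finite-limit-preserving
functors `A ⥤ Set`, with `hom X Y (a, b) = Set(X a, Y b)`, and with the composition and identities
of functions. -/
def lexSet : EnrCat.{w + 1} LexProf.{w} where
  Obj A := A.carrier ⥤ₗ Type w
  hom X Y := setHom X Y
  comp {A B C} X Y Z := tensorDesc (M := setHom X Y) (N := setHom Y Z) (P := setHom X Z)
    (fun {a b c} (f : X.obj.obj a ⟶ Y.obj.obj b) (g : Y.obj.obj b ⟶ Z.obj.obj c) => f ≫ g)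
    (fun {a a' b c} u (f : X.obj.obj a ⟶ Y.obj.obj b) (g : Y.obj.obj b ⟶ Z.obj.obj c) =>
      Category.assoc (X.obj.map u) f g)
    (fun {a b b' c} u (f : X.obj.obj a ⟶ Y.obj.obj b) (g : Y.obj.obj b' ⟶ Z.obj.obj c) =>
      (Category.assoc f (Y.obj.map u) g).symm)
    (fun {a b c c'} u (f : X.obj.obj a ⟶ Y.obj.obj b) (g : Y.obj.obj b ⟶ Z.obj.obj c) =>
      (Category.assoc f g (Z.obj.map u)).symm)
  ident {A} X := mkHom (M := one A.carrier) (N := setHom X X)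
    (fun {a b} (f : a ⟶ b) => X.obj.map f)
    (fun {a a'} u {b} (f : a ⟶ b) => X.obj.map_comp u f)
    (fun {a b b'} u (f : a ⟶ b) => X.obj.map_comp f u)
  assoc X Y Z T := tensor_hom_ext (fun q k => by
    induction q using tensor_ind with | h f g => exact Category.assoc (obj := Type w) f g k)
  ident_comp X Y := tensor_hom_ext (fun f g => rfl)
  comp_ident X Y := tensor_hom_ext (fun f g => rfl)

section FinitelyPresentable

variable {A : Type (w + 1)} [LargeCategory A] {Af : Type w} [SmallCategory Af]

/-- The functor `ι : Af ⥤ A` exhibits the small category `Af` as equivalent to the full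
subcategory of `A` on the finitely presentable objects. -/
class IsFinitelyPresentableModel (ι : Af ⥤ A) : Prop where
  full : ι.Full
  faithful : ι.Faithful
  essImage_iff (X : A) : ι.essImage X ↔ IsFinitelyPresentable.{w} X

lemma nonempty_createsColimit_of_model [IsLocallyFinitelyPresentable.{w} A] (ι : Af ⥤ A)
    [hι : IsFinitelyPresentableModel ι] (J : Type) [SmallCategory J] [FinCategory J] (K : J ⥤ Af) :
    Nonempty (CreatesColimit K ι) := by
  have := hι.full
  have := hι.faithful
  have (j : J) : IsFinitelyPresentable.{w} ((K ⋙ ι).obj j) :=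
    (hι.essImage_iff _).1 (ι.obj_mem_essImage _)
  have h : IsFinitelyPresentable.{w} (colimit (K ⋙ ι)) :=
    have : Fact (Cardinal.aleph0.{w}).IsRegular := Cardinal.fact_isRegular_aleph0
    isCardinalPresentable_of_isColimit _ (colimit.isColimit (K ⋙ ι)) _
      ((hasCardinalLT_aleph0_iff _).2 inferInstance)
  obtain ⟨X, ⟨e⟩⟩ := (hι.essImage_iff _).2 h
  exact ⟨createsColimitOfFullyFaithfulOfIso X e⟩

lemma hasFiniteLimits_op_of_model [IsLocallyFinitelyPresentable.{w} A] (ι : Af ⥤ A)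
    [hι : IsFinitelyPresentableModel ι] : HasFiniteLimits Afᵒᵖ :=
  have : HasFiniteColimits Af := ⟨fun J _ _ => ⟨fun K => by
    obtain ⟨h⟩ := nonempty_createsColimit_of_model ι J K
    exact hasColimit_of_created K ι⟩⟩
  inferInstance

lemma preservesFiniteLimits_op_of_model [IsLocallyFinitelyPresentable.{w} A] (ι : Af ⥤ A)
    [hι : IsFinitelyPresentableModel ι] : PreservesFiniteLimits ι.op :=
  have : PreservesFiniteColimits ι := ⟨fun J _ _ => ⟨fun {K} => by
    obtain ⟨h⟩ := nonempty_createsColimit_of_model ι J K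
    infer_instance⟩⟩
  preservesFiniteLimits_op ι

/-- The small finitely complete category `Afᵒᵖ` as an object of `LexProf`. -/
def fpOp [IsLocallyFinitelyPresentable.{w} A] (ι : Af ⥤ A) [IsFinitelyPresentableModel ι] :
    LexProf.{w} :=
  have := hasFiniteLimits_op_of_model ι
  ⟨Afᵒᵖ⟩

end FinitelyPresentable

section Monads

variable {A : Type (w + 1)} [LargeCategory A]

variable (A) in
/-- The property of monads on `A` of being finitary: the underlying functor preserves filtered
colimits. -/
def isFinitaryMonad : ObjectProperty (CategoryTheory.Monad A) :=
  fun T => PreservesFilteredColimitsOfSize.{w, w} T.toFunctor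

variable (A) in
/-- The category of finitary monads on `A`. -/
abbrev FinitaryMonad := (isFinitaryMonad A).FullSubcategory

variable {Af : Type w} [SmallCategory Af] [IsLocallyFinitelyPresentable.{w} A]
  (ι : Af ⥤ A) [IsFinitelyPresentableModel ι]

/-- The lex profunctor `T(a, b) = A(ι b, T (ι a))`. -/
def kleisliHom (T : CategoryTheory.Monad A) : LexProfunctor Afᵒᵖ Afᵒᵖ where
  obj a := ⟨ι.op ⋙ yoneda.obj (T.obj (ι.obj a.unop.unop)), by
    have := preservesFiniteLimits_op_of_model ι
    rw [leftExactFunctor_iff]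
    exact comp_preservesFiniteLimits _ _⟩
  map f := ObjectProperty.homMk
    (Functor.whiskerLeft ι.op (yoneda.map (T.map (ι.map f.unop.unop))))
  map_id a := by
    apply ObjectProperty.hom_ext
    apply NatTrans.ext
    funext b
    simp
  map_comp f g := by
    apply ObjectProperty.hom_ext
    apply NatTrans.ext
    funext b
    simp

/-- The unit of the monad `kleisliHom ι T`, given by postcomposition with the unit of `T`. -/
def kleisliUnit (T : CategoryTheory.Monad A) : one Afᵒᵖ ⟶ kleisliHom ι T :=
  mkHom (M := one Afᵒᵖ) (N := kleisliHom ι T)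
    (fun {a b} (f : a ⟶ b) => (ι.map f.unop ≫ T.η.app (ι.obj a.unop) :
      ι.obj b.unop ⟶ T.obj (ι.obj a.unop)))
    (fun {a a'} u {b} (f : a ⟶ b) => by
      change ι.map (u ≫ f).unop ≫ T.η.app (ι.obj a'.unop) =
        (ι.map f.unop ≫ T.η.app (ι.obj a.unop)) ≫ T.map (ι.map u.unop)
      have := T.η.naturality (ι.map u.unop)
      simp at this
      simp [this])
    (fun {a b b'} u (f : a ⟶ b) => by
      change ι.map (f ≫ u).unop ≫ T.η.app (ι.obj a.unop) =
        ι.map u.unop ≫ ι.map f.unop ≫ T.η.app (ι.obj a.unop)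
      simp)

/-- The multiplication of the monad `kleisliHom ι T`, given by Kleisli composition. -/
def kleisliMul (T : CategoryTheory.Monad A) [HasFiniteLimits Afᵒᵖ] :
    (kleisliHom ι T).tensor (kleisliHom ι T) ⟶ kleisliHom ι T :=
  tensorDesc (M := kleisliHom ι T) (N := kleisliHom ι T) (P := kleisliHom ι T)
    (fun {a b c} (m : ι.obj b.unop ⟶ T.obj (ι.obj a.unop))
        (n : ι.obj c.unop ⟶ T.obj (ι.obj b.unop)) =>
      (n ≫ T.map m ≫ T.μ.app (ι.obj a.unop) : ι.obj c.unop ⟶ T.obj (ι.obj a.unop)))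
    (fun {a a' b c} u (m : ι.obj b.unop ⟶ T.obj (ι.obj a.unop))
        (n : ι.obj c.unop ⟶ T.obj (ι.obj b.unop)) => by
      change n ≫ T.map (m ≫ T.map (ι.map u.unop)) ≫ T.μ.app (ι.obj a'.unop) =
        (n ≫ T.map m ≫ T.μ.app (ι.obj a.unop)) ≫ T.map (ι.map u.unop)
      have := T.μ.naturality (ι.map u.unop)
      simp at this
      simp [this])
    (fun {a b b' c} u (m : ι.obj b.unop ⟶ T.obj (ι.obj a.unop))
        (n : ι.obj c.unop ⟶ T.obj (ι.obj b'.unop)) => by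
      change (n ≫ T.map (ι.map u.unop)) ≫ T.map m ≫ T.μ.app (ι.obj a.unop) =
        n ≫ T.map (ι.map u.unop ≫ m) ≫ T.μ.app (ι.obj a.unop)
      simp)
    (fun {a b c c'} u (m : ι.obj b.unop ⟶ T.obj (ι.obj a.unop))
        (n : ι.obj c.unop ⟶ T.obj (ι.obj b.unop)) =>
      Category.assoc (obj := A) (X := ι.obj c.unop) (Y := T.obj (ι.obj b.unop))
        (ι.map u.unop) n (T.map m ≫ T.μ.app (ι.obj a.unop)))

/-- The monad on `Afᵒᵖ` in `LexProf` given by a monad on `A`. -/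
def kleisliMonad (T : CategoryTheory.Monad A) : EnrCat.MonadOn (fpOp ι) where
  T := kleisliHom ι T
  unit := kleisliUnit ι T
  mul :=
    have := hasFiniteLimits_op_of_model ι
    kleisliMul ι T
  assoc :=
    have := hasFiniteLimits_op_of_model ι
    (tensor_hom_ext (M := (kleisliHom ι T).tensor (kleisliHom ι T)) (N := kleisliHom ι T)
      (P := kleisliHom ι T) (fun {a _ d} q p => by
        induction q using tensor_ind with | @h b m n => 
        rename_i c
        change ι.obj b.unop ⟶ T.obj (ι.obj a.unop) at m
        change ι.obj c.unop ⟶ T.obj (ι.obj b.unop) at n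
        change ι.obj d.unop ⟶ T.obj (ι.obj c.unop) at p
        change p ≫ T.map (n ≫ T.map m ≫ T.μ.app (ι.obj a.unop)) ≫ T.μ.app (ι.obj a.unop) =
          (p ≫ T.map n ≫ T.μ.app (ι.obj b.unop)) ≫ T.map m ≫ T.μ.app (ι.obj a.unop)
        have := T.μ.naturality m
        have h2 := T.assoc (ι.obj a.unop)
        simp at this
        simp [reassoc_of% this, h2]))
  unit_mul :=
    have := hasFiniteLimits_op_of_model ι
    (tensor_hom_ext (M := one Afᵒᵖ) (N := kleisliHom ι T)
      (P := kleisliHom ι T) (fun {a b c} f m => by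
        change a ⟶ b at f
        change ι.obj c.unop ⟶ T.obj (ι.obj b.unop) at m
        change m ≫ T.map (ι.map f.unop ≫ T.η.app (ι.obj a.unop)) ≫ T.μ.app (ι.obj a.unop) =
          m ≫ T.map (ι.map f.unop)
        simp))
  mul_unit :=
    have := hasFiniteLimits_op_of_model ι
    (tensor_hom_ext (M := kleisliHom ι T) (N := one Afᵒᵖ)
      (P := kleisliHom ι T) (fun {a b c} m f => by
        change b ⟶ c at f
        change ι.obj b.unop ⟶ T.obj (ι.obj a.unop) at m
        change (ι.map f.unop ≫ T.η.app (ι.obj b.unop)) ≫ T.map m ≫ T.μ.app (ι.obj a.unop) =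
          ι.map f.unop ≫ m
        have := T.η.naturality m
        simp at this
        simp [← reassoc_of% this]))

/-- The map of monads in `LexProf` given by a map of monads on `A`, acting by postcomposition. -/
def kleisliMonadMap {T T' : CategoryTheory.Monad A} (φ : T ⟶ T') :
    (kleisliMonad ι T).Map (kleisliMonad ι T') where
  map := mkHom (M := kleisliHom ι T) (N := kleisliHom ι T')
      (fun {a b} (m : ι.obj b.unop ⟶ T.obj (ι.obj a.unop)) =>
        (m ≫ φ.app (ι.obj a.unop) : ι.obj b.unop ⟶ T'.obj (ι.obj a.unop)))
      (fun {a a'} u {b} (m : ι.obj b.unop ⟶ T.obj (ι.obj a.unop)) => by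
        change (m ≫ T.map (ι.map u.unop)) ≫ φ.app (ι.obj a'.unop) =
          (m ≫ φ.app (ι.obj a.unop)) ≫ T'.map (ι.map u.unop)
        simp [φ.naturality])
      (fun {a b b'} u (m : ι.obj b.unop ⟶ T.obj (ι.obj a.unop)) =>
        Category.assoc (obj := A) (X := ι.obj b.unop) (Y := T.obj (ι.obj a.unop))
          (ι.map u.unop) m (φ.app (ι.obj a.unop)))
  unit_map := hom_ext (M := one Afᵒᵖ) (N := kleisliHom ι T') (fun {a b} f => by
      change a ⟶ b at f
      change (ι.map f.unop ≫ T.η.app (ι.obj a.unop)) ≫ φ.app (ι.obj a.unop) =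
        ι.map f.unop ≫ T'.η.app (ι.obj a.unop)
      simp)
  mul_map :=
    have := hasFiniteLimits_op_of_model ι
    tensor_hom_ext (M := kleisliHom ι T) (N := kleisliHom ι T) (P := kleisliHom ι T')
      (fun {a b c} m n => by
        change ι.obj b.unop ⟶ T.obj (ι.obj a.unop) at m
        change ι.obj c.unop ⟶ T.obj (ι.obj b.unop) at n
        change (n ≫ T.map m ≫ T.μ.app (ι.obj a.unop)) ≫ φ.app (ι.obj a.unop) =
          (n ≫ φ.app (ι.obj b.unop)) ≫ T'.map (m ≫ φ.app (ι.obj a.unop)) ≫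
            T'.μ.app (ι.obj a.unop)
        simp)

lemma kleisliMonadMap_id (T : CategoryTheory.Monad A) :
    (kleisliMonadMap ι (𝟙 T)).map = 𝟙 (kleisliMonad ι T).T :=
  hom_ext (M := kleisliHom ι T) (N := kleisliHom ι T) (fun {a b} m =>
    Category.comp_id (obj := A) (X := ι.obj b.unop) (Y := T.obj (ι.obj a.unop)) m)

lemma kleisliMonadMap_comp {T T' T'' : CategoryTheory.Monad A} (φ : T ⟶ T') (ψ : T' ⟶ T'') :
    (kleisliMonadMap ι (φ ≫ ψ)).map = (kleisliMonadMap ι φ).map ≫ (kleisliMonadMap ι ψ).map :=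
  hom_ext (M := kleisliHom ι T) (N := kleisliHom ι T'') (fun {a b} m =>
    (Category.assoc (obj := A) (W := ι.obj b.unop) (X := T.obj (ι.obj a.unop)) m
      (φ.app (ι.obj a.unop)) (ψ.app (ι.obj a.unop))).symm)


open Bicategory.Opposite in
/-- The embedding of finitary monads on `A` as one-object `LexProf`-categories, on opposites. -/
def monadEmbedding : LocallyDiscrete (FinitaryMonad A)ᵒᵖ ⥤ᵖ (EnrCat.{w + 1} LexProf.{w})ᵒᵖ :=
  LocallyDiscrete.mkPseudofunctor
    (fun T => op (EnrCat.single (kleisliMonad ι T.unop.obj)))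
    (fun f => Quiver.Hom.op (EnrCat.singleMap (kleisliMonadMap ι f.unop.hom)))
    (fun T => Iso.op2 (EnrCat.singleMapId _ (kleisliMonadMap_id ι T.unop.obj)))
    (fun f g => Iso.op2 (EnrCat.singleMapComp _ _ _
      (kleisliMonadMap_comp ι g.unop.hom f.unop.hom)))
    (fun _ _ _ => IsEqTwoCell.eq (.comp (.op2 (EnrCat.isEqTwoCell_singleMapComp ..).1)
      (.comp (.whiskerRight (.op2 (EnrCat.isEqTwoCell_singleMapComp ..).1) _)
      (.comp (.op2 (EnrCat.isEqTwoCell_associator ..).2)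
      (.comp (.whiskerLeft _ (.op2 (EnrCat.isEqTwoCell_singleMapComp ..).2))
        (.op2 (EnrCat.isEqTwoCell_singleMapComp ..).2))))) _)
    (fun _ => IsEqTwoCell.eq (.comp (.op2 (EnrCat.isEqTwoCell_singleMapComp ..).1)
      (.comp (.whiskerRight (.op2 (EnrCat.isEqTwoCell_singleMapId ..).1) _)
        (.op2 (EnrCat.isEqTwoCell_rightUnitor _).1))) _)
    (fun _ => IsEqTwoCell.eq (.comp (.op2 (EnrCat.isEqTwoCell_singleMapComp ..).1)
      (.comp (.whiskerLeft _ (.op2 (EnrCat.isEqTwoCell_singleMapId ..).1))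
        (.op2 (EnrCat.isEqTwoCell_leftUnitor _).1))) _)

end Monads

section Algebras

variable {C D E : Type (w + 1)} [LargeCategory C] [LargeCategory D] [LargeCategory E]

/-- A functor between categories with lifted morphism sets. -/
def liftHomFunctor (F : C ⥤ D) : ULiftHom.{w + 1} C ⥤ ULiftHom.{w + 1} D :=
  ULiftHom.down.{w, w + 1} ⋙ F ⋙ ULiftHom.up.{w, w + 1}

/-- An isomorphism of functors between categories with lifted morphism sets. -/
def liftHomIso {F G : C ⥤ D} (e : F ≅ G) : liftHomFunctor F ≅ liftHomFunctor G :=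
  Functor.isoWhiskerLeft ULiftHom.down.{w, w + 1}
    (Functor.isoWhiskerRight e ULiftHom.up.{w, w + 1})

lemma eq_eqToHom_of_app {F G : C ⥤ D} (α : F ⟶ G)
    (h : ∀ X, ∃ e : F.obj X = G.obj X, α.app X = eqToHom e) : ∃ e : F = G, α = eqToHom e := by
  choose e he using h
  obtain rfl : F = G := CategoryTheory.Functor.ext e (fun X Y f => by
    have := α.naturality f
    rw [he, he] at this
    simp [← reassoc_of% this])
  refine ⟨rfl, ?_⟩
  ext X
  simp [he]

lemma liftHomIso_isEqTwoCell {F G : C ⥤ D} (e : F ≅ G)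
    (h : ∃ h' : F = G, e.hom = eqToHom h') :
    IsEqTwoCell (f := (liftHomFunctor F).toCatHom) (g := (liftHomFunctor G).toCatHom)
      (Cat.Hom.isoMk (liftHomIso e)).hom ∧
    IsEqTwoCell (f := (liftHomFunctor G).toCatHom) (g := (liftHomFunctor F).toCatHom)
      (Cat.Hom.isoMk (liftHomIso e)).inv := by
  obtain ⟨rfl, h'⟩ := h
  obtain rfl : e = Iso.refl F := by ext1; exact h'
  exact ⟨⟨rfl, rfl⟩, ⟨rfl, rfl⟩⟩

lemma algebra_eq_eqToHom {T : CategoryTheory.Monad C} {X Y : T.Algebra} (f : X ⟶ Y)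
    (h : ∃ e : X.A = Y.A, f.f = eqToHom e) : ∃ e : X = Y, f = eqToHom e := by
  obtain ⟨X, x, _, _⟩ := X
  obtain ⟨Y, y, _, _⟩ := Y
  obtain ⟨f, hf⟩ := f
  obtain ⟨h, hf'⟩ := h
  change X = Y at h
  subst h
  obtain rfl : f = 𝟙 X := hf'
  obtain rfl : x = y := by simpa using hf.symm
  exact ⟨rfl, rfl⟩

open CategoryTheory.Monad in
lemma isEqTwoCell_algebraId {T : CategoryTheory.Monad C} :
    IsEqTwoCell (f := (liftHomFunctor (algebraFunctorOfMonadHom (𝟙 T))).toCatHom)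
      (g := 𝟙 (Cat.of (ULiftHom.{w + 1} T.Algebra)))
      (Cat.Hom.isoMk (liftHomIso algebraFunctorOfMonadHomId)).hom :=
  (liftHomIso_isEqTwoCell algebraFunctorOfMonadHomId (eq_eqToHom_of_app _ (fun _ =>
    algebra_eq_eqToHom _ ⟨rfl, rfl⟩))).1

open CategoryTheory.Monad in
lemma isEqTwoCell_algebraComp {T T' T'' : CategoryTheory.Monad C} (φ : T ⟶ T') (ψ : T' ⟶ T'') :
    IsEqTwoCell (f := (liftHomFunctor (algebraFunctorOfMonadHom (φ ≫ ψ))).toCatHom)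
      (g := (liftHomFunctor (algebraFunctorOfMonadHom ψ)).toCatHom ≫
        (liftHomFunctor (algebraFunctorOfMonadHom φ)).toCatHom)
      (Cat.Hom.isoMk (liftHomIso (algebraFunctorOfMonadHomComp φ ψ))).hom ∧
    IsEqTwoCell (f := (liftHomFunctor (algebraFunctorOfMonadHom ψ)).toCatHom ≫
        (liftHomFunctor (algebraFunctorOfMonadHom φ)).toCatHom)
      (g := (liftHomFunctor (algebraFunctorOfMonadHom (φ ≫ ψ))).toCatHom)
      (Cat.Hom.isoMk (liftHomIso (algebraFunctorOfMonadHomComp φ ψ))).inv :=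
  liftHomIso_isEqTwoCell (algebraFunctorOfMonadHomComp φ ψ) (eq_eqToHom_of_app _ (fun _ =>
    algebra_eq_eqToHom _ ⟨rfl, rfl⟩))

lemma isEqTwoCell_catAssociator {X Y Z T : Cat.{v, u}} (f : X ⟶ Y) (g : Y ⟶ Z) (h : Z ⟶ T) :
    IsEqTwoCell (α_ f g h).hom :=
  ⟨rfl, rfl⟩

lemma isEqTwoCell_catUnitors {X Y : Cat.{v, u}} (f : X ⟶ Y) :
    IsEqTwoCell (λ_ f).hom ∧ IsEqTwoCell (ρ_ f).hom :=
  ⟨⟨rfl, rfl⟩, ⟨rfl, rfl⟩⟩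

end Algebras

section Monads

variable (A : Type (w + 1)) [LargeCategory A]

/-- The functor sending a finitary monad to its category of algebras. -/
def algebraPseudofunctor : LocallyDiscrete (FinitaryMonad A)ᵒᵖ ⥤ᵖ Cat.{w + 1, w + 1} :=
  LocallyDiscrete.mkPseudofunctor
    (fun T => Cat.of (ULiftHom.{w + 1} (T.unop.obj.Algebra)))
    (fun f => (liftHomFunctor
      (CategoryTheory.Monad.algebraFunctorOfMonadHom f.unop.hom)).toCatHom)
    (fun _ => Cat.Hom.isoMk (liftHomIso
      CategoryTheory.Monad.algebraFunctorOfMonadHomId))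
    (fun f g => Cat.Hom.isoMk (liftHomIso
      (CategoryTheory.Monad.algebraFunctorOfMonadHomComp g.unop.hom f.unop.hom)))
    (fun _ _ _ => IsEqTwoCell.eq (.comp (isEqTwoCell_algebraComp _ _).1
      (.comp (.whiskerRight (isEqTwoCell_algebraComp _ _).1 _)
      (.comp (isEqTwoCell_catAssociator _ _ _)
      (.comp (.whiskerLeft _ (isEqTwoCell_algebraComp _ _).2)
        (isEqTwoCell_algebraComp _ _).2)))) _)
    (fun _ => IsEqTwoCell.eq (.comp (isEqTwoCell_algebraComp _ _).1
      (.comp (.whiskerRight isEqTwoCell_algebraId _) (isEqTwoCell_catUnitors _).1)) _)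
    (fun _ => IsEqTwoCell.eq (.comp (isEqTwoCell_algebraComp _ _).1
      (.comp (.whiskerLeft _ isEqTwoCell_algebraId) (isEqTwoCell_catUnitors _).2)) _)

end Monads

/-!
The tensor of a finite-limit-preserving functor `X : A ⥤ Set` by a lex profunctor `P : A ⟶ B` is the
coend `b ↦ ∫^a P(a, b) × X(a)`, which preserves finite limits because it is a filtered colimit of
the functors `P(a, -)`; its universal property is that of the coend (`isTensored_lexSet`).

An enriched functor from the one-object category of a finitary monad `T` to `lexSet` amounts to a
finite-limit-preserving functor `X` on `Afᵒᵖ` together with an action `X(a) ⟶ X(b)` of each Kleisli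
morphism `ι b ⟶ T (ι a)`, functorial for Kleisli composition, and an enriched transformation
amounts to a natural transformation that commutes with the actions (`KleisliFunctor.act`,
`KleisliFunctor.homMk`, `KleisliFunctor.hom_ext'`). A `T`-algebra `(x, α)` gives such an action on
`A(ι -, x)`, in which `m` sends `g : ι a ⟶ x` to `m ≫ T g ≫ α`. The resulting functor `comparison`
is an equivalence for three reasons:

* `ι` is dense and the categories `ι ↓ x` are filtered, so that `x` is the filtered colimit of the
  objects `ι a` and `T x` that of the objects `T (ι a)`. Maps out of `x` and out of `T x` can thus be
  constructed and compared on the objects of `Af` (`finitary_hom_ext`, `finitary_exists_desc`),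
  which gives full faithfulness;
* every finite-limit-preserving functor on `Afᵒᵖ` is isomorphic to some `A(ι -, x)`
  (`exists_lexNerve_iso`);
* an action on `A(ι -, x)` is a compatible family of maps `T (ι a) ⟶ x` indexed by `ι ↓ x`, that is,
  a map `T x ⟶ x`, and the laws of an action are those of an algebra (`exists_algebra`).

Restricting along a map of monads commutes with `comparison` up to isomorphisms that are identities.
All the structure `2`-cells of both pseudofunctors are identities too, up to equality of `1`-cells,
so that the coherence conditions hold automatically (`strongTransOfIsEqTwoCell`).
-/

/-! ### Tensors in the enriched category of finite-limit-preserving functors -/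

/-- The functor `b ↦ ∫^a P(a, b) × X(a)`, which is the tensor of `X` by `P` in `lexSet`. -/
def lexTensor {A B : LexProf.{w}} (P : A ⟶ B) (X : A.carrier ⥤ₗ Type w) : B.carrier ⥤ₗ Type w :=
  ⟨coendFunctor X.obj P, by
    have : PreservesFiniteLimits X.obj := X.property
    exact coendFunctor_preservesFiniteLimits _ _⟩

/-- The unit `P(a, b) ⟶ Set(X(a), (P ∗ X)(b))` of the tensor, given by the coprojections of the
coend. -/
def lexTensorUnit {A B : LexProf.{w}} (P : A ⟶ B) (X : A.carrier ⥤ₗ Type w) :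
    P ⟶ setHom X (lexTensor P X) :=
  mkHom (M := P) (N := setHom X (lexTensor P X))
    (fun {a b} p => (↾(fun x => (CoendObj.mk x p : CoendObj X.obj P b)) :
      X.obj.obj a ⟶ (lexTensor P X).obj.obj b))
    (fun {a a'} u {b} p => by
      refine ConcreteCategory.hom_ext (C := Type w) _ _ (fun x => ?_)
      exact CoendObj.sound (X := X.obj) (N := P) u x p)
    (fun {a b b'} u p => rfl)

/-- A `2`-cell `P ≫ U ⟶ Set(X, Z)` descends along the coend defining `P ∗ X`. -/
def lexTensorDesc {A B C : LexProf.{w}} (P : A ⟶ B) (X : A.carrier ⥤ₗ Type w) (U : B ⟶ C)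
    (Z : C.carrier ⥤ₗ Type w) (g : P.tensor U ⟶ setHom X Z) :
    U ⟶ setHom (lexTensor P X) Z :=
  mkHom (M := U) (N := setHom (lexTensor P X) Z)
    (fun {b c} u => (↾(CoendObj.lift (X := X.obj) (N := P)
      (fun {a} (x : X.obj.obj a) p =>
        (show X.obj.obj a ⟶ Z.obj.obj c from app g (tmul p u)) x)
      (fun {a a'} v x p => congrArg (fun k : X.obj.obj a ⟶ Z.obj.obj c => k x)
        (app_lact g v (tmul p u)))) : (lexTensor P X).obj.obj b ⟶ Z.obj.obj c))
    (fun {b b'} v {c} u => by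
      refine ConcreteCategory.hom_ext (C := Type w) _ _ (fun q => ?_)
      induction q using CoendObj.ind with | @h a x p =>
      exact congrArg (fun t => (show X.obj.obj a ⟶ Z.obj.obj c from app g t) x)
        (tmul_lact v p u))
    (fun {b c c'} v u => by
      refine ConcreteCategory.hom_ext (C := Type w) _ _ (fun q => ?_)
      induction q using CoendObj.ind with | @h a x p =>
      exact congrArg (fun k : X.obj.obj a ⟶ Z.obj.obj c' => k x)
        (app_ract g v (tmul p u)))

theorem isTensored_lexSet : EnrCat.IsTensored lexSet.{w} := by
  intro A B P X
  refine ⟨lexTensor P X, lexTensorUnit P X, fun C U Z => ⟨fun f f' h => ?_, fun g => ?_⟩⟩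
  · refine hom_ext (M := U) (N := setHom (lexTensor P X) Z) (fun {b c} u => ?_)
    refine ConcreteCategory.hom_ext (C := Type w) _ _ (fun q => ?_)
    induction q using CoendObj.ind with | @h a x p =>
    exact congrArg (fun k : P.tensor U ⟶ setHom X Z =>
      (show X.obj.obj a ⟶ Z.obj.obj c from app k (tmul p u)) x) h
  · exact ⟨lexTensorDesc P X U Z g,
      tensor_hom_ext (M := P) (N := U) (P := setHom X Z) (fun p u => rfl)⟩

/-! ### Finitely presentable objects generate a locally finitely presentable category -/

section Dense

variable {A : Type (w + 1)} [LargeCategory A] {Af : Type w} [SmallCategory Af]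

lemma denseAt_cocone_app (ι : Af ⥤ A) {x : A} (j : CostructuredArrow ι x) :
    ((Functor.LeftExtension.mk (𝟭 A) ι.rightUnitor.inv).coconeAt x).ι.app j = j.hom :=
  Category.id_comp _

variable (ι : Af ⥤ A) [hι : IsFinitelyPresentableModel ι]

/-- The functor from the model to the full subcategory of finitely presentable objects. -/
abbrev modelLift : Af ⥤ (ObjectProperty.isFinitelyPresentable.{w} A).FullSubcategory :=
  ObjectProperty.lift _ ι (fun a => (hι.essImage_iff _).1 (ι.obj_mem_essImage a))

lemma isEquivalence_modelLift : (modelLift ι).IsEquivalence where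
  faithful := have := hι.faithful; 
    Functor.Faithful.of_comp_iso (ObjectProperty.liftCompιIso _ ι _)
  full := have := hι.full; have := hι.faithful
    Functor.Full.of_comp_faithful_iso (ObjectProperty.liftCompιIso _ ι _)
  essSurj := ⟨fun X => by
    obtain ⟨a, ⟨e⟩⟩ := (hι.essImage_iff X.obj).2 X.property
    exact ⟨a, ⟨ObjectProperty.isoMk _ e⟩⟩⟩

variable [IsLocallyFinitelyPresentable.{w} A]

lemma isDense_of_model : ι.IsDense := by
  have := isEquivalence_modelLift ι
  -- `modelLift ι` followed by the inclusion of the full subcategory is `ι` by definition.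
  exact inferInstanceAs ((modelLift ι ⋙ (ObjectProperty.isFinitelyPresentable.{w} A).ι).IsDense)

lemma isFiltered_costructuredArrow_of_model (x : A) : IsFiltered (CostructuredArrow ι x) := by
  have := isEquivalence_modelLift ι
  exact IsFiltered.of_equivalence (CostructuredArrow.pre (modelLift ι)
    (ObjectProperty.isFinitelyPresentable.{w} A).ι x).asEquivalence.symm

variable (T : A ⥤ A) [hT : PreservesFilteredColimitsOfSize.{w, w} T]

/-- Since `T` preserves the filtered colimit `x = colim ι a` over `ι ↓ x`, the maps
`T (ι a) ⟶ T x` are jointly epimorphic. -/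
lemma finitary_hom_ext {x y : A} {f g : T.obj x ⟶ y}
    (h : ∀ (a : Af) (k : ι.obj a ⟶ x), T.map k ≫ f = T.map k ≫ g) : f = g := by
  have := isDense_of_model ι
  have := isFiltered_costructuredArrow_of_model ι x
  exact (isColimitOfPreserves T (ι.denseAt x)).hom_ext (fun j => by
    rw [Functor.mapCocone_ι_app, denseAt_cocone_app]
    exact h j.left j.hom)

/-- Since `T` preserves the filtered colimit `x = colim ι a` over `ι ↓ x`, a compatible family of
maps out of the objects `T (ι a)` extends to `T x`. -/
lemma finitary_exists_desc {x y : A} (h : ∀ (a : Af) (_ : ι.obj a ⟶ x), T.obj (ι.obj a) ⟶ y)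
    (nat : ∀ {a b : Af} (u : a ⟶ b) (k : ι.obj b ⟶ x),
      T.map (ι.map u) ≫ h b k = h a (ι.map u ≫ k)) :
    ∃ f : T.obj x ⟶ y, ∀ (a : Af) (k : ι.obj a ⟶ x), T.map k ≫ f = h a k := by
  have := isDense_of_model ι
  have := isFiltered_costructuredArrow_of_model ι x
  let c : Cocone ((CostructuredArrow.proj ι x ⋙ ι) ⋙ T) :=
    { pt := y
      ι :=
        { app j := h j.left j.hom
          naturality i j f := by
            refine (nat f.left j.hom).trans ?_
            rw [CostructuredArrow.w]
            exact (Category.comp_id _).symm } }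
  refine ⟨(isColimitOfPreserves T (ι.denseAt x)).desc c, fun a k => ?_⟩
  have := (isColimitOfPreserves T (ι.denseAt x)).fac c (CostructuredArrow.mk k)
  rwa [Functor.mapCocone_ι_app, denseAt_cocone_app] at this

end Dense

/-! ### Finite-limit-preserving functors on the opposite of a model are representable in `A` -/

section Nerve

variable {A : Type (w + 1)} [LargeCategory A] {Af : Type w} [SmallCategory Af]
  [IsLocallyFinitelyPresentable.{w} A] (ι : Af ⥤ A) [hι : IsFinitelyPresentableModel ι]

/-- The finite-limit-preserving functor `A(ι -, x)` on `Afᵒᵖ`. -/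
def lexNerve (x : A) : lexSet.{w}.Obj (fpOp ι) :=
  (⟨ι.op ⋙ yoneda.obj x, by
    have := preservesFiniteLimits_op_of_model ι
    rw [leftExactFunctor_iff]
    exact comp_preservesFiniteLimits _ _⟩ : Afᵒᵖ ⥤ₗ Type w)

/-- A finite-limit-preserving functor `X` on `Afᵒᵖ` is `A(ι -, x)` for `x` the filtered colimit of
`ι` over the category of elements of `X`. -/
lemma exists_lexNerve_iso (X : lexSet.{w}.Obj (fpOp ι)) :
    ∃ x : A, Nonempty ((show Afᵒᵖ ⥤ₗ Type w from X).obj ≅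
      (show Afᵒᵖ ⥤ₗ Type w from lexNerve ι x).obj) := by
  change Afᵒᵖ ⥤ₗ Type w at X
  -- The category of elements is cofiltered because `X` preserves finite limits.
  have hX : PreservesFiniteLimits X.obj := X.property
  have := hasFiniteLimits_op_of_model ι
  have := hι.full
  have := hι.faithful
  have : HasFiniteLimits X.obj.Elements := ⟨fun J _ _ => inferInstance⟩
  have : IsCofiltered X.obj.Elements := IsCofiltered.of_hasFiniteLimits _
  let D : X.obj.Elementsᵒᵖ ⥤ A := (CategoryOfElements.π X.obj).leftOp ⋙ ι
  have hD := colimit.isColimit D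
  let leg {a : Afᵒᵖ} (s : X.obj.obj a) : ι.obj a.unop ⟶ colimit D :=
    colimit.ι D (op ⟨a, s⟩)
  have leg_map {a b : Afᵒᵖ} (u : a ⟶ b) (s : X.obj.obj a) :
      leg (X.obj.map u s) = ι.map u.unop ≫ leg s :=
    (colimit.w D (CategoryOfElements.homMk (F := X.obj) ⟨a, s⟩ ⟨b, X.obj.map u s⟩ u rfl).op).symm
  -- The coprojections are bijections `X(a) ≅ A(ι a, colim D)` as `ι a` is finitely presentable.
  refine ⟨colimit D, ⟨NatIso.ofComponents (fun a => Equiv.toIso (Equiv.ofBijective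
    (β := (ι.obj a.unop ⟶ colimit D)) leg ⟨fun s s' h => ?_, fun g => ?_⟩)) (fun {a b} u => ?_)⟩⟩
  · have : IsFinitelyPresentable.{w} (ι.obj a.unop) :=
      (hι.essImage_iff _).1 (ι.obj_mem_essImage _)
    obtain ⟨⟨⟨c, t⟩⟩, u, v, huv⟩ := IsFinitelyPresentable.exists_eq_of_isColimit hD
      (i := op ⟨a, s⟩) (j := op ⟨a, s'⟩) (𝟙 (ι.obj a.unop)) (𝟙 (ι.obj a.unop))
      (congrArg (𝟙 _ ≫ ·) h)
    have hu : X.obj.map u.unop.val t = s := u.unop.property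
    have hv : X.obj.map v.unop.val t = s' := v.unop.property
    have huv' : ι.map u.unop.val.unop = ι.map v.unop.val.unop  :=
      ((Category.id_comp _).symm.trans huv).trans (Category.id_comp _)
    rw [← hu, ← hv, Quiver.Hom.unop_inj (ι.map_injective huv')]
  · have : IsFinitelyPresentable.{w} (ι.obj a.unop) :=
      (hι.essImage_iff _).1 (ι.obj_mem_essImage _)
    obtain ⟨⟨⟨c, t⟩⟩, p, hp⟩ := IsFinitelyPresentable.exists_hom_of_isColimit hD g
    obtain ⟨q, hq⟩ := ι.map_surjective (Y := c.unop) p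
    refine ⟨X.obj.map q.op t, (leg_map q.op t).trans ?_⟩
    rw [← hp]
    exact congrArg (· ≫ _) hq
  · refine ConcreteCategory.hom_ext (C := Type w) _ _ (fun s => ?_)
    exact leg_map u s

end Nerve

/-! ### Enriched functors from a Kleisli monad -/

section Kleisli

variable {A : Type (w + 1)} [LargeCategory A] {Af : Type w} [SmallCategory Af]
  [IsLocallyFinitelyPresentable.{w} A] (ι : Af ⥤ A) [hι : IsFinitelyPresentableModel ι]
  (T : CategoryTheory.Monad A)

/-- The `LexProf`-category with a single object attached to the monad `T`. -/
abbrev kleisliCat : EnrCat.{w + 1} LexProf.{w} := EnrCat.single.{w + 1} (kleisliMonad ι T)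

variable {ι T}

namespace KleisliFunctor

variable {F G H : EnrFunctor (kleisliCat ι T) lexSet.{w}}

variable (F)

/-- The finite-limit-preserving functor that is the image of the unique object. -/
def carrier : Afᵒᵖ ⥤ₗ Type w := F.obj EnrCat.Single.star

/-- The map `X(a) ⟶ X(b)` by which a Kleisli morphism `ι b ⟶ T (ι a)` acts on the carrier. -/
def act {a b : Af} (m : ι.obj b ⟶ T.obj (ι.obj a)) :
    (carrier F).obj.obj (op a) ⟶ (carrier F).obj.obj (op b) :=
  app (M := kleisliHom ι T) (N := setHom (carrier F) (carrier F))
    (F.map EnrCat.Single.star EnrCat.Single.star) (a := op a) (b := op b) m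

lemma act_comp_map {a a' b : Af} (u : a ⟶ a') (m : ι.obj b ⟶ T.obj (ι.obj a)) :
    act F (m ≫ T.map (ι.map u)) = (carrier F).obj.map u.op ≫ act F m :=
  app_lact (M := kleisliHom ι T) (N := setHom (carrier F) (carrier F))
    (F.map EnrCat.Single.star EnrCat.Single.star) (a := op a) (a' := op a') u.op
      (b := op b) m

lemma act_map_comp {a b b' : Af} (u : b' ⟶ b) (m : ι.obj b ⟶ T.obj (ι.obj a)) :
    act F (ι.map u ≫ m) = act F m ≫ (carrier F).obj.map u.op :=
  app_ract (M := kleisliHom ι T) (N := setHom (carrier F) (carrier F))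
    (F.map EnrCat.Single.star EnrCat.Single.star) (a := op a) (b := op b) (b' := op b') u.op m

lemma act_unit (a : Af) : act F (T.η.app (ι.obj a)) = 𝟙 _ := by
  have h := congrArg (fun k => app (M := one Afᵒᵖ) (N := setHom (carrier F) (carrier F)) k
    (a := op a) (b := op a) (ofHom (𝟙 (op a)))) (F.map_ident EnrCat.Single.star)
  have h' : act F (ι.map (𝟙 a) ≫ T.η.app (ι.obj a)) = (carrier F).obj.map (𝟙 (op a)) := h
  rwa [CategoryTheory.Functor.map_id, Category.id_comp, CategoryTheory.Functor.map_id] at h'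

lemma act_mul {a b c : Af} (m : ι.obj b ⟶ T.obj (ι.obj a)) (n : ι.obj c ⟶ T.obj (ι.obj b)) :
    act F (n ≫ T.map m ≫ T.μ.app (ι.obj a)) = act F m ≫ act F n := by
  have := hasFiniteLimits_op_of_model ι
  exact congrArg (fun k => app (M := (kleisliHom ι T).tensor (kleisliHom ι T))
    (N := setHom (carrier F) (carrier F)) k (a := op a) (b := op c)
      (tmul (M := kleisliHom ι T) (N := kleisliHom ι T) (b := op b) m n))
      (F.map_comp EnrCat.Single.star EnrCat.Single.star EnrCat.Single.star)

variable {F}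

/-- The component at `a` of the natural transformation of carriers given by `α`: the value of `α`
at the identity of `a`, which determines `α` by the Yoneda lemma. -/
def comp (α : F ⟶ G) (a : Af) :
    (carrier F).obj.obj (op a) ⟶ (carrier G).obj.obj (op a) :=
  app (M := one Afᵒᵖ) (N := setHom (carrier F) (carrier G))
    (EnrTrans.app α EnrCat.Single.star) (ofHom (𝟙 (op a)))

lemma app_ofHom (α : F ⟶ G) {a b : Af} (u : b ⟶ a) :
    app (M := one Afᵒᵖ) (N := setHom (carrier F) (carrier G))
      (EnrTrans.app α EnrCat.Single.star) (ofHom u.op) =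
        comp α a ≫ (carrier G).obj.map u.op := by
  have := app_ract (M := one Afᵒᵖ) (N := setHom (carrier F) (carrier G))
    (EnrTrans.app α EnrCat.Single.star) u.op (ofHom (𝟙 (op a)))
  rw [ract_ofHom, Category.id_comp] at this
  exact this

lemma comp_naturality (α : F ⟶ G) {a b : Af} (u : b ⟶ a) :
    (carrier F).obj.map u.op ≫ comp α b = comp α a ≫ (carrier G).obj.map u.op := by
  rw [← app_ofHom]
  have := app_lact (M := one Afᵒᵖ) (N := setHom (carrier F) (carrier G))
    (EnrTrans.app α EnrCat.Single.star) u.op (ofHom (𝟙 (op b)))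
  rw [lact_ofHom, Category.comp_id] at this
  exact this.symm

/-- Naturality of an enriched transformation, in terms of the actions. -/
lemma act_comp (α : F ⟶ G) {a b : Af} (m : ι.obj b ⟶ T.obj (ι.obj a)) :
    act F m ≫ comp α b = comp α a ≫ act G m :=
  congrArg (fun k => app (M := kleisliHom ι T) (N := setHom (carrier F) (carrier G)) k
    (a := op a) (b := op b) m) (EnrTrans.naturality α EnrCat.Single.star EnrCat.Single.star)

lemma hom_ext' {α β : F ⟶ G} (h : ∀ a, comp α a = comp β a) : α = β := by
  refine EnrTrans.hom_ext (fun {a} X => ?_)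
  cases X
  refine hom_ext (M := one Afᵒᵖ) (N := setHom (carrier F) (carrier G)) (fun {a b} u => ?_)
  exact (app_ofHom α (Quiver.Hom.unop (show a ⟶ b from u))).trans ((congrArg (· ≫ _) (h _)).trans
    (app_ofHom β (Quiver.Hom.unop (show a ⟶ b from u))).symm)

@[simp] lemma comp_id (a : Af) : comp (𝟙 F) a = 𝟙 _ :=
  (carrier F).obj.map_id (op a)

@[simp] lemma comp_comp (α : F ⟶ G) (β : G ⟶ H) (a : Af) :
    comp (α ≫ β) a = comp α a ≫ comp β a := rfl

/-- An enriched transformation is a natural transformation of the carriers that commutes with the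
actions of Kleisli morphisms. -/
def homMk (t : (carrier F).obj ⟶ (carrier G).obj)
    (ht : ∀ {a b : Af} (m : ι.obj b ⟶ T.obj (ι.obj a)),
      act F m ≫ t.app (op b) = t.app (op a) ≫ act G m) : F ⟶ G where
  app X := match X with
    | .star => mkHom (M := one Afᵒᵖ) (N := setHom (carrier F) (carrier G))
        (fun {a b} (u : a ⟶ b) => t.app a ≫ (carrier G).obj.map u)
        (fun {a a'} u {b} (v : a ⟶ b) => by
          change t.app a' ≫ (carrier G).obj.map (u ≫ v) =
            (carrier F).obj.map u ≫ t.app a ≫ (carrier G).obj.map v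
          simp)
        (fun {a b b'} u (v : a ⟶ b) => by
          change t.app a ≫ (carrier G).obj.map (v ≫ u) =
            (t.app a ≫ (carrier G).obj.map v) ≫ (carrier G).obj.map u
          simp)
  naturality X Y := match X, Y with
    | .star, .star => hom_ext (M := kleisliHom ι T) (N := setHom (carrier F) (carrier G))
        (fun {a b} m => by
          change act F (a := a.unop) (b := b.unop) m ≫ t.app b ≫ (carrier G).obj.map (𝟙 b) =
            (t.app a ≫ (carrier G).obj.map (𝟙 a)) ≫ act G (a := a.unop) (b := b.unop) m
          rw [CategoryTheory.Functor.map_id, CategoryTheory.Functor.map_id, Category.comp_id,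
            Category.comp_id]
          exact ht _)

@[simp] lemma comp_homMk (t : (carrier F).obj ⟶ (carrier G).obj) (ht) (a : Af) :
    comp (homMk (F := F) (G := G) t ht) a = t.app (op a) := by
  change t.app (op a) ≫ (carrier G).obj.map (𝟙 (op a)) = t.app (op a)
  simp

/-- An isomorphism of carriers that commutes with the actions of Kleisli morphisms is an
isomorphism of enriched functors. -/
def isoMk (t : (carrier F).obj ≅ (carrier G).obj)
    (ht : ∀ {a b : Af} (m : ι.obj b ⟶ T.obj (ι.obj a)),
      act F m ≫ t.hom.app (op b) = t.hom.app (op a) ≫ act G m) : F ≅ G where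
  hom := homMk t.hom ht
  inv := homMk t.inv (fun {a b} m => by
    rw [← cancel_epi (t.hom.app (op a)), ← reassoc_of% ht]
    simp)
  hom_inv_id := hom_ext' (fun a => by simp)
  inv_hom_id := hom_ext' (fun a => by simp)

end KleisliFunctor

end Kleisli

/-! ### The comparison functor -/

section Comparison

variable {A : Type (w + 1)} [LargeCategory A] {Af : Type w} [SmallCategory Af]
  [IsLocallyFinitelyPresentable.{w} A] (ι : Af ⥤ A) [hι : IsFinitelyPresentableModel ι]
  (T : CategoryTheory.Monad A)

/-- The action on objects of an enriched functor out of a one-object enriched category. -/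
def singleObj {P : LexProf.{w}} (X : lexSet.{w}.Obj P) {a : LexProf.{w}} :
    EnrCat.Single.{w + 1} P a → lexSet.{w}.Obj a
  | .star => X

/-- The enriched functor given by a `T`-algebra `(x, α)`: its carrier is `A(ι -, x)`, and a Kleisli
morphism `m` acts by `g ↦ m ≫ T g ≫ α`. -/
def algebraToEnrFunctor (x : T.Algebra) : EnrFunctor (kleisliCat ι T) lexSet.{w} where
  obj X := singleObj (lexNerve ι x.A) X
  map X Y := match X, Y with
    | .star, .star => mkHom (M := kleisliHom ι T) (N := setHom (lexNerve ι x.A) (lexNerve ι x.A))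
        (fun {a b} (m : ι.obj b.unop ⟶ T.obj (ι.obj a.unop)) =>
          (↾(fun g : ι.obj a.unop ⟶ x.A => m ≫ T.map g ≫ x.a) :
            (ι.obj a.unop ⟶ x.A) ⟶ (ι.obj b.unop ⟶ x.A)))
        (fun {a a'} u {b} (m : ι.obj b.unop ⟶ T.obj (ι.obj a.unop)) => by
          refine ConcreteCategory.hom_ext (C := Type w) _ _
            (fun g : ι.obj a'.unop ⟶ x.A => ?_)
          change (m ≫ T.map (ι.map u.unop)) ≫ T.map g ≫ x.a =
            m ≫ T.map (ι.map u.unop ≫ g) ≫ x.a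
          simp)
        (fun {a b b'} u (m : ι.obj b.unop ⟶ T.obj (ι.obj a.unop)) => by
          refine ConcreteCategory.hom_ext (C := Type w) _ _
            (fun g : ι.obj a.unop ⟶ x.A => ?_)
          exact Category.assoc (ι.map u.unop) m (T.map g ≫ x.a))
  map_ident X := match X with
    | .star => hom_ext (M := one Afᵒᵖ) (N := setHom (lexNerve ι x.A) (lexNerve ι x.A))
        (fun {a b} u => by
          change a ⟶ b at u
          refine ConcreteCategory.hom_ext (C := Type w) _ _
            (fun g : ι.obj a.unop ⟶ x.A => ?_)
          change (ι.map u.unop ≫ T.η.app (ι.obj a.unop)) ≫ T.map g ≫ x.a = ι.map u.unop ≫ g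
          have := T.η.naturality g
          simp only [Functor.id_obj, Functor.id_map] at this
          rw [Category.assoc, ← reassoc_of% this, x.unit, Category.comp_id])
  map_comp X Y Z := match X, Y, Z with
    | .star, .star, .star =>
        have := hasFiniteLimits_op_of_model ι
        tensor_hom_ext (M := kleisliHom ι T) (N := kleisliHom ι T)
          (P := setHom (lexNerve ι x.A) (lexNerve ι x.A)) (fun {a b c} m n => by
            change ι.obj b.unop ⟶ T.obj (ι.obj a.unop) at m
            change ι.obj c.unop ⟶ T.obj (ι.obj b.unop) at n
            refine ConcreteCategory.hom_ext (C := Type w) _ _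
              (fun g : ι.obj a.unop ⟶ x.A => ?_)
            change (n ≫ T.map m ≫ T.μ.app (ι.obj a.unop)) ≫ T.map g ≫ x.a =
              n ≫ T.map (m ≫ T.map g ≫ x.a) ≫ x.a
            have := T.μ.naturality g
            simp only [Functor.comp_map] at this
            simp only [Category.assoc, Functor.map_comp, ← x.assoc, ← reassoc_of% this])

variable {T}

open KleisliFunctor

/-- The enriched transformation given by a homomorphism of algebras. -/
def algebraHomToEnrTrans {x y : T.Algebra} (f : x ⟶ y) :
    algebraToEnrFunctor ι T x ⟶ algebraToEnrFunctor ι T y :=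
  homMk (F := algebraToEnrFunctor ι T x) (G := algebraToEnrFunctor ι T y)
    (Functor.whiskerLeft ι.op (yoneda.map f.f)) (fun {a b} m => by
      refine ConcreteCategory.hom_ext (C := Type w) _ _ (fun g : ι.obj a ⟶ x.A => ?_)
      change (m ≫ T.map g ≫ x.a) ≫ f.f = m ≫ T.map (g ≫ f.f) ≫ y.a
      simp [f.h])

lemma comp_algebraHomToEnrTrans {x y : T.Algebra} (f : x ⟶ y) {a : Af} (g : ι.obj a ⟶ x.A) :
    (show ι.obj a ⟶ y.A from KleisliFunctor.comp (algebraHomToEnrTrans ι f) a g) = g ≫ f.f :=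
  congrArg (fun k : (ι.obj a ⟶ x.A) ⟶ (ι.obj a ⟶ y.A) => k g)
    (comp_homMk (F := algebraToEnrFunctor ι T x) (G := algebraToEnrFunctor ι T y) _ _ a)

variable (T)

/-- The functor sending a `T`-algebra to the enriched functor of its actions. -/
def comparison : T.Algebra ⥤ EnrFunctor (kleisliCat ι T) lexSet.{w} where
  obj x := algebraToEnrFunctor ι T x
  map f := algebraHomToEnrTrans ι f
  map_id x := hom_ext' (fun a => ConcreteCategory.hom_ext (C := Type w) _ _
    (fun g : ι.obj a ⟶ x.A => (comp_algebraHomToEnrTrans ι (𝟙 x) g).trans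
      ((Category.comp_id g).trans
        (congrArg (fun k : (ι.obj a ⟶ x.A) ⟶ (ι.obj a ⟶ x.A) => k g)
          (KleisliFunctor.comp_id (F := algebraToEnrFunctor ι T x) a)).symm)))
  map_comp {x y z} f g := hom_ext' (fun a => ConcreteCategory.hom_ext (C := Type w) _ _
    (fun k : ι.obj a ⟶ x.A => (comp_algebraHomToEnrTrans ι (f ≫ g) k).trans
      ((Category.assoc k f.f g.f).symm.trans
        (((comp_algebraHomToEnrTrans ι g (k ≫ f.f)).symm).trans
          (congrArg (fun l : ι.obj a ⟶ y.A => (show ι.obj a ⟶ z.A from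
            KleisliFunctor.comp (algebraHomToEnrTrans ι g) a l))
              (comp_algebraHomToEnrTrans ι f k).symm)))))

lemma comp_comparison_map {x y : T.Algebra} (f : x ⟶ y) {a : Af} (g : ι.obj a ⟶ x.A) :
    (show ι.obj a ⟶ y.A from KleisliFunctor.comp ((comparison ι T).map f) a g) = g ≫ f.f :=
  comp_algebraHomToEnrTrans ι f g

variable [hT : PreservesFilteredColimitsOfSize.{w, w} T.toFunctor]

/-- The objects of the form `ι a` are jointly separating. -/
lemma model_hom_ext {x y : A} {f g : x ⟶ y}
    (h : ∀ (a : Af) (k : ι.obj a ⟶ x), k ≫ f = k ≫ g) : f = g :=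
  finitary_hom_ext ι (𝟭 A) h

instance faithful_comparison : (comparison ι T).Faithful where
  map_injective {x y f g} h := by
    ext
    refine model_hom_ext ι (fun a k => ?_)
    rw [← comp_comparison_map, ← comp_comparison_map, h]

instance full_comparison : (comparison ι T).Full where
  map_surjective {x y} φ := by
    obtain ⟨f, hf⟩ := finitary_exists_desc ι (𝟭 A) (x := x.A) (y := y.A)
      (fun a k => (KleisliFunctor.comp φ a k : ι.obj a ⟶ y.A)) (fun {a b} u k =>
        (congrArg (fun t : (ι.obj b ⟶ x.A) ⟶ (ι.obj a ⟶ y.A) => t k)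
          (comp_naturality φ u)).symm)
    replace hf : ∀ (a : Af) (k : ι.obj a ⟶ x.A), k ≫ f = (KleisliFunctor.comp φ a k :) := hf
    refine ⟨⟨f, ?_⟩, ?_⟩
    · -- The maps `ι b ⟶ T (ι a) ⟶ T x` are jointly epimorphic.
      refine finitary_hom_ext ι T.toFunctor (fun a k => model_hom_ext ι (fun b m => ?_))
      have := congrArg (fun t : (ι.obj a ⟶ x.A) ⟶ (ι.obj b ⟶ y.A) => t k) (act_comp φ m)
      change (KleisliFunctor.comp φ b (m ≫ T.map k ≫ x.a) : ι.obj b ⟶ y.A) =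
        m ≫ T.map (KleisliFunctor.comp φ a k : ι.obj a ⟶ y.A) ≫ y.a at this
      rw [← hf, ← hf] at this
      simp only [Functor.map_comp, Category.assoc] at this ⊢
      exact this.symm
    · refine hom_ext' (fun a => ConcreteCategory.hom_ext (C := Type w) _ _
        (fun k : ι.obj a ⟶ x.A => ?_))
      exact (comp_comparison_map ι T _ k).trans (hf a k)

/-- An action of the Kleisli morphisms on `A(ι -, x)` comes from a `T`-algebra structure on `x`:
since `T x` is the colimit of the objects `T (ι a)` over `ι ↓ x`, and `ι` is dense, there is a
unique `T x ⟶ x` that induces the action. -/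
lemma exists_algebra {x : A}
    (ρ : ∀ {a b : Af} (_ : ι.obj b ⟶ T.obj (ι.obj a)) (_ : ι.obj a ⟶ x), ι.obj b ⟶ x)
    (hl : ∀ {a a' b : Af} (u : a ⟶ a') (m : ι.obj b ⟶ T.obj (ι.obj a)) (g : ι.obj a' ⟶ x),
      ρ (m ≫ T.map (ι.map u)) g = ρ m (ι.map u ≫ g))
    (hr : ∀ {a b b' : Af} (u : b' ⟶ b) (m : ι.obj b ⟶ T.obj (ι.obj a)) (g : ι.obj a ⟶ x),
      ρ (ι.map u ≫ m) g = ι.map u ≫ ρ m g)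
    (unit : ∀ {a : Af} (g : ι.obj a ⟶ x), ρ (T.η.app (ι.obj a)) g = g)
    (mul : ∀ {a b c : Af} (m : ι.obj b ⟶ T.obj (ι.obj a)) (n : ι.obj c ⟶ T.obj (ι.obj b))
      (g : ι.obj a ⟶ x), ρ (n ≫ T.map m ≫ T.μ.app (ι.obj a)) g = ρ n (ρ m g)) :
    ∃ α : T.obj x ⟶ x, T.η.app x ≫ α = 𝟙 x ∧ T.μ.app x ≫ α = T.map α ≫ α ∧
      ∀ {a b : Af} (m : ι.obj b ⟶ T.obj (ι.obj a)) (g : ι.obj a ⟶ x),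
        m ≫ T.map g ≫ α = ρ m g := by
  have H (a : Af) (g : ι.obj a ⟶ x) : ∃ f : T.obj (ι.obj a) ⟶ x,
      ∀ (b : Af) (m : ι.obj b ⟶ T.obj (ι.obj a)), m ≫ f = ρ m g :=
    finitary_exists_desc ι (𝟭 A) (x := T.obj (ι.obj a)) (fun b m => ρ m g)
      (fun {b b'} u m => (hr u m g).symm)
  choose p hp using H
  obtain ⟨α, hα⟩ := finitary_exists_desc ι T.toFunctor p (fun {a b} u g =>
    model_hom_ext ι (fun c m => by rw [hp, ← hl, ← hp, Category.assoc]))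
  have key {a b : Af} (m : ι.obj b ⟶ T.obj (ι.obj a)) (g : ι.obj a ⟶ x) :
      m ≫ T.map g ≫ α = ρ m g := by rw [hα, hp]
  refine ⟨α, ?_, ?_, key⟩
  · refine model_hom_ext ι (fun a g => ?_)
    exact (T.η.naturality_assoc g α).trans ((key _ g).trans ((unit g).trans
      (Category.comp_id g).symm))
  · -- `T (T x)` is covered by the maps `ι c ⟶ T (ι b) ⟶ T (T (ι a)) ⟶ T (T x)`.
    refine finitary_hom_ext ι (T.toFunctor ⋙ T.toFunctor) (fun a g => ?_)
    refine finitary_hom_ext ι T.toFunctor (fun b m => model_hom_ext ι (fun c n => ?_))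
    have hμ : T.map (T.map g) ≫ T.μ.app x ≫ α = T.μ.app (ι.obj a) ≫ T.map g ≫ α :=
      T.μ.naturality_assoc g α
    change n ≫ T.map m ≫ T.map (T.map g) ≫ T.μ.app x ≫ α =
      n ≫ T.map m ≫ T.map (T.map g) ≫ T.map α ≫ α
    have h₁ := key (n ≫ T.map m ≫ T.μ.app (ι.obj a)) g
    have h₂ := key n (m ≫ T.map g ≫ α)
    simp only [Category.assoc, Functor.map_comp] at h₁ h₂
    rw [hμ, h₁, h₂, mul, key]

instance essSurj_comparison : (comparison ι T).EssSurj where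
  mem_essImage F := by
    obtain ⟨x, ⟨e⟩⟩ := exists_lexNerve_iso ι (F.obj EnrCat.Single.star)
    change (carrier F).obj ≅ (lexNerve ι x : Afᵒᵖ ⥤ₗ Type w).obj at e
    let fwd (a : Af) : (carrier F).obj.obj (op a) ⟶ (ι.obj a ⟶ x) := e.hom.app (op a)
    let bwd (a : Af) : (ι.obj a ⟶ x) ⟶ (carrier F).obj.obj (op a) := e.inv.app (op a)
    have fwd_bwd (a : Af) : fwd a ≫ bwd a = 𝟙 _ := e.hom_inv_id_app (op a)
    have bwd_fwd (a : Af) : bwd a ≫ fwd a = 𝟙 _ := e.inv_hom_id_app (op a)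
    have fwd_bwd_apply (a : Af) (k) : bwd a (fwd a k) = k :=
      ConcreteCategory.congr_hom (fwd_bwd a) k
    have bwd_fwd_apply (a : Af) (k) : fwd a (bwd a k) = k :=
      ConcreteCategory.congr_hom (bwd_fwd a) k
    have fwd_nat {a b : Af} (u : b ⟶ a) (k) : fwd b ((carrier F).obj.map u.op k) =
        ι.map u ≫ fwd a k := ConcreteCategory.congr_hom (e.hom.naturality u.op) k
    have bwd_nat {a b : Af} (u : b ⟶ a) (k) : bwd b (ι.map u ≫ k) =
        (carrier F).obj.map u.op (bwd a k) :=
      ConcreteCategory.congr_hom (e.inv.naturality u.op) k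
    -- The action on the carrier of `F`, transported to `A(ι -, x)`.
    obtain ⟨α, unit, assoc, hα⟩ := exists_algebra ι T (x := x)
      (fun {a b} m g => fwd b (act F m (bwd a g)))
      (fun u m g => by rw [act_comp_map, bwd_nat]; rfl)
      (fun u m g => by rw [act_map_comp, ← fwd_nat]; rfl)
      (fun g => by rw [act_unit]; exact bwd_fwd_apply _ g)
      (fun m n g => by rw [act_mul, fwd_bwd_apply]; rfl)
    let y : T.Algebra := { A := x, a := α, unit := unit, assoc := assoc }
    refine ⟨y, ⟨(isoMk (F := F) (G := algebraToEnrFunctor ι T y) e (fun {a b} m => ?_)).symm⟩⟩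
    refine ConcreteCategory.hom_ext (C := Type w) _ _ (fun k => ?_)
    change fwd b (act F m k) = m ≫ T.map (fwd a k) ≫ α
    rw [hα, fwd_bwd_apply]

end Comparison

/-! ### Pseudonaturality -/

namespace IsEqTwoCell

variable {B : Type*} [Bicategory B] {x y : B}

/-- Two parallel `2`-cells that are identities up to equalities are equal, by proof irrelevance. -/
lemma eq_of {f g : x ⟶ y} {α β : f ⟶ g} (hα : IsEqTwoCell α) (hβ : IsEqTwoCell β) :
    α = β :=
  hβ.choose_spec ▸ hα.eq hβ.choose

lemma inv {f g : x ⟶ y} {e : f ≅ g} (h : IsEqTwoCell e.hom) : IsEqTwoCell e.inv := by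
  obtain ⟨rfl, h⟩ := h
  obtain rfl : e = Iso.refl f := by ext1; exact h
  exact ⟨rfl, rfl⟩

lemma map₂ {C : Type*} [Bicategory C] (F : B ⥤ᵖ C) {f g : x ⟶ y} {α : f ⟶ g}
    (h : IsEqTwoCell α) : IsEqTwoCell (F.map₂ α) := by
  obtain ⟨rfl, rfl⟩ := h
  exact ⟨rfl, F.map₂_id f⟩

lemma of_locallyDiscrete {C : Type*} [Category* C] {a b : LocallyDiscrete C} {f g : a ⟶ b}
    (α : f ⟶ g) : IsEqTwoCell α :=
  ⟨LocallyDiscrete.eq_of_hom α, Subsingleton.elim _ _⟩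

/-- A transformation between functors is an identity, up to an equality of functors, as soon as its
components are identities up to equalities of objects. -/
lemma of_app {C D : Cat.{v, u}} {F G : C ⟶ D} (α : F ⟶ G)
    (h : ∀ X, ∃ e : F.toFunctor.obj X = G.toFunctor.obj X, α.toNatTrans.app X = eqToHom e) :
    IsEqTwoCell α := by
  choose e he using h
  obtain rfl : F = G := Cat.Hom.ext (CategoryTheory.Functor.ext e (fun X Y f => by
    have := α.toNatTrans.naturality f
    rw [he, he] at this
    simp [← reassoc_of% this]))
  refine ⟨rfl, ?_⟩
  ext X
  simp [he]

end IsEqTwoCell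

lemma isEqTwoCell_yoneda₀_mapId {W : Type u} [Bicategory.{w, v} W] (S : EnrCat.{t} W)
    (C : (EnrCat.{t} W)ᵒᵖ) : IsEqTwoCell ((Bicategory.yoneda₀ S).mapId C).hom :=
  .of_app _ (fun F => (EnrCat.isEqTwoCell_leftUnitor F).1)

lemma isEqTwoCell_yoneda₀_mapComp {W : Type u} [Bicategory.{w, v} W] (S : EnrCat.{t} W)
    {C D E : (EnrCat.{t} W)ᵒᵖ} (f : C ⟶ D) (g : D ⟶ E) :
    IsEqTwoCell ((Bicategory.yoneda₀ S).mapComp f g).hom :=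
  .of_app _ (fun F => (EnrCat.isEqTwoCell_associator g.unop f.unop F).1)

/-- Between pseudofunctors whose structure `2`-cells are identities, a family of `1`-cells that is
natural up to identity `2`-cells is a strong transformation. -/
def strongTransOfIsEqTwoCell {C D : Type*} [Category* C] [Bicategory D]
    (hα : ∀ {a b c d : D} (f : a ⟶ b) (g : b ⟶ c) (h : c ⟶ d), IsEqTwoCell (α_ f g h).hom)
    (hl : ∀ {a b : D} (f : a ⟶ b), IsEqTwoCell (λ_ f).hom)
    (hr : ∀ {a b : D} (f : a ⟶ b), IsEqTwoCell (ρ_ f).hom)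
    {F G : LocallyDiscrete C ⥤ᵖ D} (app : ∀ a, F.obj a ⟶ G.obj a)
    (nat : ∀ {a b} (f : a ⟶ b), F.map f ≫ app b ≅ app a ≫ G.map f)
    (hnat : ∀ {a b} (f : a ⟶ b), IsEqTwoCell (nat f).hom)
    (hFi : ∀ a, IsEqTwoCell (F.mapId a).hom)
    (hFc : ∀ {a b c} (f : a ⟶ b) (g : b ⟶ c), IsEqTwoCell (F.mapComp f g).hom)
    (hGi : ∀ a, IsEqTwoCell (G.mapId a).hom)
    (hGc : ∀ {a b c} (f : a ⟶ b) (g : b ⟶ c), IsEqTwoCell (G.mapComp f g).hom) :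
    Pseudofunctor.StrongTrans F G where
  app := app
  naturality := nat
  naturality_naturality η :=
    IsEqTwoCell.eq_of (((IsEqTwoCell.of_locallyDiscrete η).map₂ F |>.whiskerRight _).comp (hnat _))
      ((hnat _).comp ((IsEqTwoCell.of_locallyDiscrete η).map₂ G |>.whiskerLeft _))
  naturality_id a :=
    IsEqTwoCell.eq_of ((hnat _).comp ((hGi a).whiskerLeft _))
      (((hFi a).whiskerRight _).comp ((hl _).comp (hr _).inv))
  naturality_comp f g :=
    IsEqTwoCell.eq_of ((hnat _).comp ((hGc f g).whiskerLeft _))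
      (((hFc f g).whiskerRight _).comp ((hα _ _ _).comp (((hnat g).whiskerLeft _).comp
        ((hα _ _ _).inv.comp (((hnat f).whiskerRight _).comp (hα _ _ _))))))

section Pseudonaturality

variable {A : Type (w + 1)} [LargeCategory A] {Af : Type w} [SmallCategory Af]
  [IsLocallyFinitelyPresentable.{w} A] (ι : Af ⥤ A) [hι : IsFinitelyPresentableModel ι]

lemma map_singleMap_algebraToEnrFunctor {S T : CategoryTheory.Monad A} (φ : S ⟶ T) (x : T.Algebra)
    {a b : LexProf.{w}} (X : (kleisliCat ι S).Obj a) (Y : (kleisliCat ι S).Obj b) :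
    (algebraToEnrFunctor ι S
      ((CategoryTheory.Monad.algebraFunctorOfMonadHom φ).obj x)).map X Y =
    ((EnrCat.singleMap (kleisliMonadMap ι φ)).comp (algebraToEnrFunctor ι T x)).map X Y := by
  cases X
  cases Y
  refine hom_ext (M := kleisliHom ι S) (N := setHom (lexNerve ι x.A) (lexNerve ι x.A))
    (fun {a b} m => ?_)
  change ι.obj b.unop ⟶ S.obj (ι.obj a.unop) at m
  refine ConcreteCategory.hom_ext (C := Type w) _ _ (fun g : ι.obj a.unop ⟶ x.A => ?_)
  change m ≫ S.map g ≫ φ.app x.A ≫ x.a = (m ≫ φ.app (ι.obj a.unop)) ≫ T.map g ≫ x.a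
  simp

/-- Restricting an algebra along `φ` and restricting its enriched functor along the map of Kleisli
monads given by `φ` agree. -/
def algebraToEnrFunctorIso {S T : CategoryTheory.Monad A} (φ : S ⟶ T) (x : T.Algebra) :
    algebraToEnrFunctor ι S ((CategoryTheory.Monad.algebraFunctorOfMonadHom φ).obj x) ≅
      (EnrCat.singleMap (kleisliMonadMap ι φ)).comp (algebraToEnrFunctor ι T x) :=
  EnrTrans.isoOfMap _ _ _ _ _ _ _ (map_singleMap_algebraToEnrFunctor ι φ x)

lemma algebraToEnrFunctorIso_hom_eq {S T : CategoryTheory.Monad A} (φ : S ⟶ T) (x : T.Algebra) :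
    ∃ e, (algebraToEnrFunctorIso ι φ x).hom = eqToHom e :=
  EnrTrans.isoOfMap_hom_eq _ _ _ _ _ _ _ (map_singleMap_algebraToEnrFunctor ι φ x)

/-- The comparison functors are natural in the monad. -/
def comparisonNaturality {S T : CategoryTheory.Monad A} (φ : S ⟶ T) :
    CategoryTheory.Monad.algebraFunctorOfMonadHom φ ⋙ comparison ι S ≅
      comparison ι T ⋙ (Bicategory.precomposing _ _ lexSet.{w}).obj
        (show kleisliCat ι S ⟶ kleisliCat ι T from EnrCat.singleMap (kleisliMonadMap ι φ)) :=
  NatIso.ofComponents (fun x => algebraToEnrFunctorIso ι φ x) (fun {x y} f => by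
    refine EnrTrans.hom_ext (fun {a} X => ?_)
    cases X
    exact (lexSet.{w}.unit_mul_ident _).trans (lexSet.{w}.unit_ident_mul _).symm)

/-- The comparison functors form a pseudonatural transformation. -/
def comparisonTrans : Pseudofunctor.StrongTrans (algebraPseudofunctor A)
    ((monadEmbedding ι).comp (Bicategory.yoneda₀ lexSet.{w})) :=
  strongTransOfIsEqTwoCell isEqTwoCell_catAssociator (fun f => (isEqTwoCell_catUnitors f).1)
    (fun f => (isEqTwoCell_catUnitors f).2)
    (fun T => (ULiftHom.down ⋙ comparison ι T.as.unop.obj).toCatHom)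
    (fun f => Cat.Hom.isoMk (Functor.isoWhiskerLeft ULiftHom.down
      (comparisonNaturality ι f.as.unop.hom)))
    (fun f => .of_app _ (fun _ => algebraToEnrFunctorIso_hom_eq ι f.as.unop.hom _))
    (fun _ => isEqTwoCell_algebraId)
    (fun _ _ => (isEqTwoCell_algebraComp _ _).1)
    (fun _ => ((IsEqTwoCell.op2 (EnrCat.isEqTwoCell_singleMapId _ _).1).map₂ _).comp
      (isEqTwoCell_yoneda₀_mapId _ _))
    (fun _ _ => ((IsEqTwoCell.op2 (EnrCat.isEqTwoCell_singleMapComp _ _ _ _).1).map₂ _).comp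
      (isEqTwoCell_yoneda₀_mapComp _ _ _))

lemma isEquivalence_comparisonTrans_app (T : LocallyDiscrete (FinitaryMonad A)ᵒᵖ) :
    ((comparisonTrans ι).app T).toFunctor.IsEquivalence := by
  have : PreservesFilteredColimitsOfSize.{w, w} T.as.unop.obj.toFunctor := T.as.unop.property
  have : (comparison ι T.as.unop.obj).IsEquivalence := {}
  have : (ULiftHom.down.{w, w + 1} (C := T.as.unop.obj.Algebra)).IsEquivalence :=
    inferInstanceAs (ULiftHom.equiv (C := T.as.unop.obj.Algebra)).inverse.IsEquivalence
  exact inferInstanceAs (ULiftHom.down ⋙ comparison ι T.as.unop.obj).IsEquivalence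

end Pseudonaturality

theorem mainTheorem9 {A : Type (w + 1)} [LargeCategory A] [IsLocallyFinitelyPresentable.{w} A]
    {Af : Type w} [SmallCategory Af] (ι : Af ⥤ A) [IsFinitelyPresentableModel ι] :
    EnrCat.IsTensored lexSet.{w} ∧
      ∃ η : Pseudofunctor.StrongTrans (algebraPseudofunctor A)
          ((monadEmbedding ι).comp (Bicategory.yoneda₀ lexSet.{w})),
        ∀ T : LocallyDiscrete (FinitaryMonad A)ᵒᵖ, (η.app T).toFunctor.IsEquivalence :=
  ⟨isTensored_lexSet, comparisonTrans ι, isEquivalence_comparisonTrans_app ι⟩
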